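/- Let $\Bbbk$ be a commutative ring, let $\delta,\delta'\in\Bbbk$ and $n\in\mathbb{N}=\{1,2,\dots\}$, and put $\mathbf{n}=\{1,\dots,n,1',\dots,n'\}$. The partial Brauer algebra $\mathfrak{R}_n(\delta,\delta')$ is the unital associative $\Bbbk$-algebra that is free as a $\Bbbk$-module on the set of all partitions of $\mathbf{n}$ into pairs and singletons, with multiplication given on basis elements by $d\cdot d'=\delta^{k}\,\delta'^{\,k'}\,(d\circ d')$. Here $d|d'$ denotes the concatenation of the diagrams of $d$ (on the left) and $d'$ (on the right), in which the vertex $i'$ of $d$ is identified with the vertex $i$ of $d'$ for each $i$; $d\circ d'$ is the partition that the connected components of $d|d'$ induce on the outer vertices (the left vertices of $d$ and the right vertices of $d'$); $k$ is the number of closed loops and $k'$ the number of open strings among the components of $d|d'$ that contain no outer vertex (such a component is an open string if it contains a singleton part of $d$ or of $d'$, and a closed loop otherwise). For $m\ge 0$, the Brauer algebra $\mathfrak{B}_m(\delta)$ is the free $\Bbbk$-module on the set of all partitions of $\mathbf{m}=\{1,\dots,m,1',\dots,m'\}$ into pairs, with multiplication $d\cdot d'=\delta^{k}(d\circ d')$,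 $k$ being the number of closed loops of $d|d'$. Suppose that $\delta'$ and $\delta-1$ are units of $\Bbbk$. Then $\mathfrak{R}_n(\delta,\delta')$ is Morita equivalent to the direct sum of algebras $\mathfrak{B}_n(\delta-1)\oplus\mathfrak{B}_{n-1}(\delta-1)$; that is, their categories of left modules are equivalent as $\Bbbk$-linear categories. -/

import Mathlib

/-! # Partial Brauer algebras and Brauer algebras -/

/-- A partial pair partition of `S`: a partition of `S` (given as an equivalence relation)
all of whose parts have at most two elements, i.e. a partition into pairs and singletons. -/
@[ext]
structure PairPartition (S : Type*) extends Setoid S where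
  card_le_two : ∀ x y z, r x y → r x z → x = y ∨ x = z ∨ y = z

/-- `{x}` is a part of the partition. -/
def PairPartition.IsSingleton {S : Type*} (d : PairPartition S) (x : S) : Prop :=
  ∀ y, d.r x y → y = x

/-- Partial Brauer diagrams with left vertices `α` and right vertices `β`. -/
abbrev PBDiagram (α β : Type*) := PairPartition (α ⊕ β)

namespace PBDiagram

open Sum

variable {α β γ ε : Type*}

/-- The lines of the concatenation `d|d'`, whose vertices are the left vertices `α`, the
vertices `β` on the equator, and the right vertices `γ`. -/
inductive JuxtRel (d : PBDiagram α β) (d' : PBDiagram β γ) : α ⊕ β ⊕ γ → α ⊕ β ⊕ γ → Prop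
  | left (x y : α ⊕ β) (h : d.r x y) : JuxtRel d d' (Sum.map id inl x) (Sum.map id inl y)
  | right (x y : β ⊕ γ) (h : d'.r x y) : JuxtRel d d' (inr x) (inr y)

/-- The partition of the vertices of `d|d'` into connected components. -/
def juxt (d : PBDiagram α β) (d' : PBDiagram β γ) : Setoid (α ⊕ β ⊕ γ) :=
  Relation.EqvGen.setoid (JuxtRel d d')

/-- The number of closed loops of `d|d'`: connected components that lie in the equator and
contain no singleton of `d` or `d'`. -/
noncomputable def loops (d : PBDiagram α β) (d' : PBDiagram β γ) : ℕ :=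
  {C ∈ (juxt d d').classes | ∀ x ∈ C, ∃ b : β, x = inr (inl b) ∧
    ¬ d.IsSingleton (inr b) ∧ ¬ d'.IsSingleton (inl b)}.ncard

/-- The number of open strings of `d|d'`: connected components that lie in the equator and
contain a singleton of `d` or `d'` (equivalently, that are not loops; a string may consist of
a single vertex, where two singletons meet). -/
noncomputable def openStrings (d : PBDiagram α β) (d' : PBDiagram β γ) : ℕ :=
  {C ∈ (juxt d d').classes | (∀ x ∈ C, ∃ b : β, x = inr (inl b)) ∧
    ∃ b : β, inr (inl b) ∈ C ∧ (d.IsSingleton (inr b) ∨ d'.IsSingleton (inl b))}.ncard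

/-! ### Ends of components: the composite of two diagrams is a diagram -/

section Ends

variable {S : Type*}

open Classical in
/-- The other element of the part of `x`, or `x` itself if `{x}` is a part. -/
noncomputable def partner (d : PairPartition S) (x : S) : S :=
  if h : ∃ y, d.r x y ∧ y ≠ x then h.choose else x

theorem rel_partner (d : PairPartition S) (x : S) : d.r x (partner d x) := by
  unfold partner
  split_ifs with h
  · exact h.choose_spec.1
  · exact d.iseqv.refl x

theorem partner_eq_self (d : PairPartition S) (x : S) : partner d x = x ↔ d.IsSingleton x := by
  constructor
  · intro h y hy
    by_contra hne
    have hex : ∃ y, d.r x y ∧ y ≠ x := ⟨y, hy, hne⟩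
    unfold partner at h
    rw [dif_pos hex] at h
    exact hex.choose_spec.2 h
  · intro h
    exact h _ (rel_partner d x)

theorem eq_partner (d : PairPartition S) {x y : S} (h : d.r x y) : y = x ∨ y = partner d x := by
  rcases d.card_le_two x y (partner d x) h (rel_partner d x) with h1 | h1 | h1
  · exact Or.inl h1.symm
  · exact Or.inl ((partner_eq_self d x).1 h1.symm y h)
  · exact Or.inr h1

theorem partner_partner (d : PairPartition S) (x : S) : partner d (partner d x) = x := by
  rcases eq_partner d (d.iseqv.symm (rel_partner d x)) with h | h
  · rw [← h, ← h]
  · exact h.symm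

/-- The two involutions on the vertices of `d|d'` that follow the lines of `d` (for `false`)
and of `d'` (for `true`). -/
noncomputable def follow (d : PBDiagram α β) (d' : PBDiagram β γ) :
    Bool → α ⊕ β ⊕ γ → α ⊕ β ⊕ γ
  | false, inl a => Sum.map id inl (partner d (inl a))
  | false, inr (inl b) => Sum.map id inl (partner d (inr b))
  | false, inr (inr c) => inr (inr c)
  | true, inl a => inl a
  | true, inr x => inr (partner d' x)

theorem follow_left (d : PBDiagram α β) (d' : PBDiagram β γ) (x : α ⊕ β) :
    follow d d' false (Sum.map id inl x) = Sum.map id inl (partner d x) := by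
  rcases x with a | b <;> rfl

theorem follow_follow (d : PBDiagram α β) (d' : PBDiagram β γ) (s : Bool) (x : α ⊕ β ⊕ γ) :
    follow d d' s (follow d d' s x) = x := by
  rcases s with _ | _
  · rcases x with a | b | c
    · change follow d d' false (Sum.map id inl (partner d (inl a))) = _
      rw [follow_left, partner_partner]; rfl
    · change follow d d' false (Sum.map id inl (partner d (inr b))) = _
      rw [follow_left, partner_partner]; rfl
    · rfl
  · rcases x with a | x
    · rfl
    · simp [follow, partner_partner]

theorem juxt_follow (d : PBDiagram α β) (d' : PBDiagram β γ) (s : Bool) (x : α ⊕ β ⊕ γ) :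
    (juxt d d').r x (follow d d' s x) := by
  rcases s with _ | _
  · rcases x with a | b | c
    · exact .rel _ _ (.left (inl a) _ (rel_partner d _))
    · exact .rel _ _ (.left (inr b) _ (rel_partner d _))
    · exact .refl _
  · rcases x with a | x
    · exact .refl _
    · exact .rel _ _ (.right x _ (rel_partner d' _))

theorem JuxtRel.eq_follow {d : PBDiagram α β} {d' : PBDiagram β γ} {x y : α ⊕ β ⊕ γ}
    (h : JuxtRel d d' x y) : y = x ∨ ∃ s, y = follow d d' s x := by
  cases h with
  | left x y h =>
    rcases eq_partner d h with rfl | rfl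
    · exact Or.inl rfl
    · exact Or.inr ⟨false, (follow_left d d' x).symm⟩
  | right x y h =>
    rcases eq_partner d' h with rfl | rfl
    · exact Or.inl rfl
    · exact Or.inr ⟨true, rfl⟩

theorem JuxtRel.symm {d : PBDiagram α β} {d' : PBDiagram β γ} {x y : α ⊕ β ⊕ γ}
    (h : JuxtRel d d' x y) : JuxtRel d d' y x := by
  cases h with
  | left x y h => exact .left _ _ (d.iseqv.symm h)
  | right x y h => exact .right _ _ (d'.iseqv.symm h)

/-- A property that is transported along a symmetric relation is transported along the
equivalence relation that it generates. -/
theorem eqvGen_transport {V : Type*} {R : V → V → Prop} (hs : ∀ x y, R x y → R y x)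
    (P : V → Prop) (hP : ∀ x y, R x y → P x → P y) {x y : V}
    (h : Relation.EqvGen R x y) : P x → P y := by
  have key : P x ↔ P y := by
    induction h with
    | rel x y h => exact ⟨hP _ _ h, hP _ _ (hs _ _ h)⟩
    | refl x => exact Iff.rfl
    | symm x y _ ih => exact ih.symm
    | trans x y z _ _ ih1 ih2 => exact ih1.trans ih2
  exact key.1

/-- An orbit of two involutions of a finite set that contains a fixed point of one of them
contains exactly two such fixed points, counted with the involution that fixes them. -/
theorem two_ends {V : Type*} [Finite V] (f : Bool → V → V) (hf : ∀ s x, f s (f s x) = x)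
    (T : Setoid V) (hT : ∀ s x, T.r x (f s x))
    (hmin : ∀ P : V → Prop, (∀ s x, P x → P (f s x)) → ∀ x y, T.r x y → P x → P y)
    (p : V × Bool) (hp : f p.2 p.1 = p.1) :
    ∃ q : V × Bool, q ≠ p ∧ f q.2 q.1 = q.1 ∧ T.r p.1 q.1 ∧
      ∀ r : V × Bool, f r.2 r.1 = r.1 → T.r p.1 r.1 → r = p ∨ r = q := by
  obtain ⟨x, s⟩ := p
  simp only at hp
  let σ : Bool → Equiv.Perm V := fun s => ⟨f s, f s, hf s, hf s⟩
  have hσ : ∀ s, σ s * σ s = 1 := fun s => Equiv.ext (hf s)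
  have hσi : ∀ s, (σ s)⁻¹ = σ s := fun s => inv_eq_of_mul_eq_one_left (hσ s)
  let c : Equiv.Perm V := σ s * σ (!s)
  have hci : c⁻¹ = σ (!s) * σ s := by simp only [c, mul_inv_rev, hσi]
  have hconj : ∀ k : ℤ, σ s * c ^ k = c ^ (-k) * σ s := by
    intro k
    have h1 : σ s * c * (σ s)⁻¹ = c⁻¹ := by
      rw [hci, hσi]; simp only [c, ← mul_assoc, hσ, one_mul]
    have h2 : σ s * c ^ k * (σ s)⁻¹ = c ^ (-k) := by
      rw [← conj_zpow, h1, inv_zpow, zpow_neg]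
    rw [← h2]; group
  have hxs : σ s x = x := hp
  have ha : ∀ k : ℤ, f s ((c ^ k) x) = (c ^ (-k)) x := by
    intro k
    change (σ s * c ^ k) x = _
    rw [hconj, Equiv.Perm.mul_apply, hxs]
  have hb : ∀ k : ℤ, f (!s) ((c ^ k) x) = (c ^ (-k - 1)) x := by
    intro k
    have h1 : σ (!s) = σ s * c := by simp only [c, ← mul_assoc, hσ, one_mul]
    change (σ (!s) * c ^ k) x = _
    rw [h1, mul_assoc, ← zpow_one_add, hconj, Equiv.Perm.mul_apply, hxs]
    congr 2; ring
  have horb : ∀ y, T.r x y → ∃ k : ℤ, y = (c ^ k) x := by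
    intro y hy
    refine hmin (fun y => ∃ k : ℤ, y = (c ^ k) x) ?_ x y hy ⟨0, by simp⟩
    rintro t y ⟨k, rfl⟩
    rcases Bool.eq_or_eq_not t s with rfl | rfl
    · exact ⟨_, ha k⟩
    · exact ⟨_, hb k⟩
  have hcT : ∀ k : ℤ, T.r x ((c ^ k) x) := by
    have h1 : ∀ y, T.r y (c y) := fun y => T.iseqv.trans (hT (!s) y) (hT s _)
    have h2 : ∀ (k : ℕ) y, T.r y ((c ^ k) y) := by
      intro k
      induction k with
      | zero => intro y; exact T.iseqv.refl y
      | succ k ih =>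
        intro y
        rw [pow_succ', Equiv.Perm.mul_apply]
        exact T.iseqv.trans (ih y) (h1 _)
    intro k
    obtain ⟨k, rfl | rfl⟩ := k.eq_nat_or_neg
    · rw [zpow_natCast]; exact h2 k x
    · have h3 := h2 k ((c ^ (-(k : ℤ))) x)
      have h4 : (c ^ k) ((c ^ (-(k : ℤ))) x) = x := by
        rw [← Equiv.Perm.mul_apply, ← zpow_natCast, ← zpow_add]; simp
      rw [h4] at h3
      exact T.iseqv.symm h3
  have hper : ∃ m : ℕ, 0 < m ∧ ∀ k : ℤ, (c ^ k) x = x ↔ (m : ℤ) ∣ k := by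
    refine ⟨Function.minimalPeriod c x, ?_, ?_⟩
    · apply Function.minimalPeriod_pos_of_mem_periodicPts
      exact (Function.Injective.mem_periodicPts c.injective x)
    · intro k
      rw [show (⇑c) = (fun y => c • y) from rfl]
      exact (MulAction.zpow_smul_eq_iff_minimalPeriod_dvd (a := c) (b := x) (n := k))
  obtain ⟨m, hm, hper⟩ := hper
  have heq : ∀ k l : ℤ, (c ^ k) x = (c ^ l) x ↔ (m : ℤ) ∣ k - l := by
    intro k l
    rw [← hper, show k - l = -l + k by ring, zpow_add, Equiv.Perm.mul_apply, zpow_neg,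
      Equiv.Perm.inv_eq_iff_eq]
  have hea : ∀ k : ℤ, f s ((c ^ k) x) = (c ^ k) x ↔ (m : ℤ) ∣ 2 * k := by
    intro k
    rw [ha, heq, ← dvd_neg]; congr! 1; ring
  have heb : ∀ k : ℤ, f (!s) ((c ^ k) x) = (c ^ k) x ↔ (m : ℤ) ∣ 2 * k + 1 := by
    intro k
    rw [hb, heq, ← dvd_neg]; congr! 1; ring
  have hss : (!s) ≠ s := by cases s <;> simp
  rcases Nat.even_or_odd' m with ⟨l, hl | hl⟩
  · have hxne : (c ^ (l : ℤ)) x ≠ x := by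
      rw [Ne, hper]
      rintro ⟨t, ht⟩
      subst hl
      push_cast at ht
      have hl0 : (0 : ℤ) < l := by omega
      have : (1 : ℤ) = 2 * t := by
        apply mul_left_cancel₀ hl0.ne'
        linarith
      omega
    refine ⟨((c ^ (l : ℤ)) x, s), ?_, ?_, hcT _, ?_⟩
    · intro h; exact hxne (congrArg Prod.fst h)
    · refine (hea _).2 ⟨1, ?_⟩
      rw [hl]; push_cast; ring
    · rintro ⟨y, t⟩ hy hxy
      obtain ⟨k, rfl⟩ := horb y hxy
      simp only at hy
      rcases Bool.eq_or_eq_not t s with rfl | rfl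
      · obtain ⟨w, hw⟩ := (hea _).1 hy
        have hk : k = l * w := by
          rw [hl] at hw; push_cast at hw; linarith
        rcases Int.even_or_odd' w with ⟨z, hz | hz⟩
        · left
          refine Prod.ext ?_ rfl
          refine (hper k).2 ⟨z, ?_⟩
          rw [hk, hz, hl]; push_cast; ring
        · right
          refine Prod.ext ?_ rfl
          refine (heq k l).2 ⟨z, ?_⟩
          rw [hk, hz, hl]; push_cast; ring
      · obtain ⟨w, hw⟩ := (heb _).1 hy
        exfalso
        rw [hl] at hw; push_cast at hw
        rw [mul_assoc] at hw
        omega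
  · refine ⟨((c ^ (l : ℤ)) x, !s), ?_, ?_, hcT _, ?_⟩
    · intro h; exact hss (congrArg Prod.snd h)
    · refine (heb _).2 ⟨1, ?_⟩
      rw [hl]; push_cast; ring
    · rintro ⟨y, t⟩ hy hxy
      obtain ⟨k, rfl⟩ := horb y hxy
      simp only at hy
      have hcop : IsCoprime (m : ℤ) 2 := ⟨1, -l, by rw [hl]; push_cast; ring⟩
      rcases Bool.eq_or_eq_not t s with rfl | rfl
      · left
        refine Prod.ext ?_ rfl
        exact (hper k).2 (hcop.dvd_of_dvd_mul_left ((hea _).1 hy))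
      · right
        refine Prod.ext ?_ rfl
        refine (heq k l).2 (hcop.dvd_of_dvd_mul_left ?_)
        have h1 := (heb _).1 hy
        have h2 : (2 : ℤ) * (k - l) = 2 * k + 1 - m := by rw [hl]; push_cast; ring
        rw [h2]
        exact dvd_sub_self_right.2 h1

theorem juxt_two_ends [Finite α] [Finite β] [Finite γ] (d : PBDiagram α β) (d' : PBDiagram β γ)
    (p : (α ⊕ β ⊕ γ) × Bool) (hp : follow d d' p.2 p.1 = p.1) :
    ∃ q : (α ⊕ β ⊕ γ) × Bool, q ≠ p ∧ follow d d' q.2 q.1 = q.1 ∧ (juxt d d').r p.1 q.1 ∧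
      ∀ r : (α ⊕ β ⊕ γ) × Bool, follow d d' r.2 r.1 = r.1 → (juxt d d').r p.1 r.1 →
        r = p ∨ r = q := by
  refine two_ends (follow d d') (follow_follow d d') (juxt d d') (juxt_follow d d') ?_ p hp
  intro P hP x y hxy
  refine eqvGen_transport (fun _ _ h => h.symm) P ?_ hxy
  intro x y h hx
  rcases h.eq_follow with rfl | ⟨s, rfl⟩
  · exact hx
  · exact hP s x hx

/-- The side on which an exterior vertex of `d|d'` is not incident to a diagram. -/
def freeSide : α ⊕ γ → Bool
  | inl _ => true
  | inr _ => false

theorem follow_freeSide (d : PBDiagram α β) (d' : PBDiagram β γ) (x : α ⊕ γ) :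
    follow d d' (freeSide x) (Sum.map id inr x) = Sum.map id inr x := by
  rcases x with a | c <;> rfl

end Ends

/-- The composite `d ∘ d'`: the partition that the components of `d|d'` induce on the exterior
vertices. -/
def comp [Finite α] [Finite β] [Finite γ] (d : PBDiagram α β) (d' : PBDiagram β γ) :
    PBDiagram α γ where
  toSetoid := (juxt d d').comap (Sum.map id inr)
  card_le_two := by
    intro x y z hxy hxz
    have hinj : Function.Injective (Sum.map id inr : α ⊕ γ → α ⊕ β ⊕ γ) :=
      Function.Injective.sumMap Function.injective_id inr_injective
    obtain ⟨q, -, -, -, hq⟩ := juxt_two_ends d d' (Sum.map id inr x, freeSide x)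
      (follow_freeSide d d' x)
    have h1 := hq (Sum.map id inr y, freeSide y) (follow_freeSide d d' y) hxy
    have h2 := hq (Sum.map id inr z, freeSide z) (follow_freeSide d d' z) hxz
    rcases h1 with h1 | h1
    · exact Or.inl (hinj (congrArg Prod.fst h1)).symm
    rcases h2 with h2 | h2
    · exact Or.inr (Or.inl (hinj (congrArg Prod.fst h2)).symm)
    · exact Or.inr (Or.inr (hinj (congrArg Prod.fst (h1.trans h2.symm))))

/-- The identity diagram, with parts `{i, i'}`. -/
def one (α : Type*) : PBDiagram α α where
  toSetoid := Setoid.ker (Sum.elim id id)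
  card_le_two := by
    rintro (x | x) (y | y) (z | z) h1 h2 <;> simp_all

/-! ### Associativity -/

theorem follow_false_mid (d : PBDiagram α β) (d' : PBDiagram β γ) (b : β) :
    follow d d' false (inr (inl b)) = inr (inl b) ↔ d.IsSingleton (inr b) := by
  rw [← partner_eq_self]
  change Sum.map id inl (partner d (inr b)) = Sum.map id inl (inr b) ↔ _
  exact (Function.Injective.sumMap Function.injective_id inl_injective).eq_iff

theorem follow_false_left (d : PBDiagram α β) (d' : PBDiagram β γ) (a : α) :
    follow d d' false (inl a) = inl a ↔ d.IsSingleton (inl a) := by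
  rw [← partner_eq_self]
  change Sum.map id inl (partner d (inl a)) = Sum.map id inl (inl a) ↔ _
  exact (Function.Injective.sumMap Function.injective_id inl_injective).eq_iff

theorem follow_true_inr (d : PBDiagram α β) (d' : PBDiagram β γ) (x : β ⊕ γ) :
    follow d d' true (inr x) = inr x ↔ d'.IsSingleton x := by
  rw [← partner_eq_self]
  exact inr_injective.eq_iff

/-- A vertex on the equator of `d|d'` that is a singleton of `d` or of `d'`. -/
def MidSingle (d : PBDiagram α β) (d' : PBDiagram β γ) : α ⊕ β ⊕ γ → Prop
  | inr (inl b) => d.IsSingleton (inr b) ∨ d'.IsSingleton (inl b)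
  | _ => False

/-- An exterior vertex of `d|d'` that is a singleton of `d` or of `d'`. -/
def ExtSingle (d : PBDiagram α β) (d' : PBDiagram β γ) : α ⊕ γ → Prop
  | inl a => d.IsSingleton (inl a)
  | inr c => d'.IsSingleton (inr c)

theorem midSingle_iff (d : PBDiagram α β) (d' : PBDiagram β γ) (b : β) :
    MidSingle d d' (inr (inl b)) ↔ ∃ s, follow d d' s (inr (inl b)) = inr (inl b) := by
  rw [Bool.exists_bool, follow_false_mid, follow_true_inr]; rfl

theorem extSingle_iff (d : PBDiagram α β) (d' : PBDiagram β γ) (x : α ⊕ γ) :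
    ExtSingle d d' x ↔ follow d d' (!freeSide x) (Sum.map id inr x) = Sum.map id inr x := by
  rcases x with a | c
  · exact (follow_false_left d d' a).symm
  · exact (follow_true_inr d d' (inr c)).symm

theorem comp_isSingleton [Finite α] [Finite β] [Finite γ] (d : PBDiagram α β)
    (d' : PBDiagram β γ) (x : α ⊕ γ) :
    (comp d d').IsSingleton x ↔
      ExtSingle d d' x ∨ ∃ v, (juxt d d').r (Sum.map id inr x) v ∧ MidSingle d d' v := by
  have hinj : Function.Injective (Sum.map id inr : α ⊕ γ → α ⊕ β ⊕ γ) :=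
    Function.Injective.sumMap Function.injective_id inr_injective
  obtain ⟨q, hqp, hqf, hqr, hq⟩ := juxt_two_ends d d' (Sum.map id inr x, freeSide x)
    (follow_freeSide d d' x)
  constructor
  · intro h
    have hext : ∀ y : α ⊕ γ, q.1 = Sum.map id inr y → ExtSingle d d' x := by
      intro y hy
      have hyx : y = x := h y (by
        change (juxt d d').r _ _
        rw [← hy]; exact hqr)
      subst hyx
      rw [extSingle_iff]
      have hs : q.2 = !freeSide y := by
        rcases Bool.eq_or_eq_not q.2 (freeSide y) with h1 | h1
        · exact absurd (Prod.ext hy h1) hqp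
        · exact h1
      rw [← hs, ← hy]; exact hqf
    obtain ⟨v, s⟩ := q
    rcases v with a | b | c
    · exact Or.inl (hext (inl a) rfl)
    · exact Or.inr ⟨_, hqr, (midSingle_iff d d' b).2 ⟨s, hqf⟩⟩
    · exact Or.inl (hext (inr c) rfl)
  · intro h y hy
    rcases hq (Sum.map id inr y, freeSide y) (follow_freeSide d d' y) hy with h1 | h1
    · exact hinj (congrArg Prod.fst h1)
    rcases h with h | ⟨v, hv, hs⟩
    · rcases hq (Sum.map id inr x, !freeSide x) ((extSingle_iff d d' x).1 h)
        ((juxt d d').iseqv.refl _) with h2 | h2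
      · exact absurd (congrArg Prod.snd h2) (by cases freeSide x <;> simp)
      · exact hinj (congrArg Prod.fst (h1.trans h2.symm))
    · rcases v with a | b | c
      · exact hs.elim
      · obtain ⟨s, hs⟩ := (midSingle_iff d d' b).1 hs
        have hne : ∀ z : α ⊕ γ, (inr (inl b) : α ⊕ β ⊕ γ) ≠ Sum.map id inr z := by
          rintro (z | z) <;> simp
        rcases hq (inr (inl b), s) hs hv with h2 | h2
        · exact absurd (congrArg Prod.fst h2) (hne x)
        · exact absurd (congrArg Prod.fst (h2.trans h1.symm)) (hne y)
      · exact hs.elim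

/-- The classes of `T` inside `H` that contain an element of `F` (for `b = True`), respectively
no element of `F` (for `b = False`). -/
def hiddenClasses {V : Type*} (T : Setoid V) (H F : V → Prop) (b : Prop) : Set (Set V) :=
  {C ∈ T.classes | (∀ x ∈ C, H x) ∧ ((∃ x ∈ C, F x) ↔ b)}

/-- Gluing of a relation `T₁` on `V₁` and a relation `R` on `U` along `D`: `T` is generated on the
glued set `V` by `T₁` and `R`, and `T'` is generated on `U` by `R` and the restriction of `T₁`. -/
structure Gluing {D V₁ U V : Type*} (i : V₁ → V) (j : U → V) (e : D → V₁) (e' : D → U)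
    (T₁ : Setoid V₁) (R : U → U → Prop) (T' : Setoid U) (T : Setoid V) : Prop where
  inj_i : Function.Injective i
  inj_j : Function.Injective j
  square : ∀ d, i (e d) = j (e' d)
  pushout : ∀ v u, i v = j u → ∃ d, v = e d ∧ u = e' d
  cover : ∀ w, (∃ v, i v = w) ∨ ∃ u, j u = w
  T_of_T₁ : ∀ v v', T₁.r v v' → T.r (i v) (i v')
  T_of_R : ∀ u u', R u u' → T.r (j u) (j u')
  T_min : ∀ P : V → Prop, (∀ v v', T₁.r v v' → P (i v) → P (i v')) →
    (∀ u u', R u u' → P (j u) → P (j u')) → ∀ w w', T.r w w' → P w → P w'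
  T'_of_T₁ : ∀ d d', T₁.r (e d) (e d') → T'.r (e' d) (e' d')
  T'_of_R : ∀ u u', R u u' → T'.r u u'
  T'_min : ∀ P : U → Prop, (∀ d d', T₁.r (e d) (e d') → P (e' d) → P (e' d')) →
    (∀ u u', R u u' → P u → P u') → ∀ u u', T'.r u u' → P u → P u'

namespace Gluing

variable {D V₁ U V : Type*} {i : V₁ → V} {j : U → V} {e : D → V₁} {e' : D → U}
  {T₁ : Setoid V₁} {R : U → U → Prop} {T' : Setoid U} {T : Setoid V}

theorem from_U (g : Gluing i j e e' T₁ R T' T) (u : U) (w : V) (h : T.r (j u) w) :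
    (∃ u', j u' = w ∧ T'.r u u') ∨ ∃ v d, i v = w ∧ T₁.r v (e d) ∧ T'.r u (e' d) := by
  refine g.T_min (fun w => (∃ u', j u' = w ∧ T'.r u u') ∨
    ∃ v d, i v = w ∧ T₁.r v (e d) ∧ T'.r u (e' d)) ?_ ?_ _ _ h
    (Or.inl ⟨u, rfl, T'.iseqv.refl u⟩)
  · rintro v v' hv (⟨u', hu', h1⟩ | ⟨v'', d, hv'', h1, h2⟩)
    · obtain ⟨d, rfl, rfl⟩ := g.pushout v u' hu'.symm
      exact Or.inr ⟨v', d, rfl, T₁.iseqv.symm hv, h1⟩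
    · rw [g.inj_i hv''] at h1
      exact Or.inr ⟨v', d, rfl, T₁.iseqv.trans (T₁.iseqv.symm hv) h1, h2⟩
  · rintro u₁ u₂ hu (⟨u', hu', h1⟩ | ⟨v, d, hv, h1, h2⟩)
    · rw [g.inj_j hu'] at h1
      exact Or.inl ⟨u₂, rfl, T'.iseqv.trans h1 (g.T'_of_R _ _ hu)⟩
    · obtain ⟨d', rfl, rfl⟩ := g.pushout v u₁ hv
      refine Or.inl ⟨u₂, rfl, T'.iseqv.trans h2 (T'.iseqv.trans ?_ (g.T'_of_R _ _ hu))⟩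
      exact g.T'_of_T₁ _ _ (T₁.iseqv.symm h1)

theorem T_iff_T' (g : Gluing i j e e' T₁ R T' T) (u u' : U) :
    T.r (j u) (j u') ↔ T'.r u u' := by
  constructor
  · intro h
    rcases g.from_U u _ h with ⟨u'', h1, h2⟩ | ⟨v, d, h1, h2, h3⟩
    · rwa [← g.inj_j h1]
    · obtain ⟨d', rfl, rfl⟩ := g.pushout v u' h1
      exact T'.iseqv.trans h3 (g.T'_of_T₁ _ _ (T₁.iseqv.symm h2))
  · intro h
    refine g.T'_min (fun u' => T.r (j u) (j u')) ?_ ?_ u u' h (T.iseqv.refl _)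
    · intro d d' h1 h2
      rw [← g.square] at h2 ⊢
      exact T.iseqv.trans h2 (g.T_of_T₁ _ _ h1)
    · intro u₁ u₂ h1 h2
      exact T.iseqv.trans h2 (g.T_of_R _ _ h1)

theorem from_hidden (g : Gluing i j e e' T₁ R T' T) (v : V₁) (hv : ∀ d, ¬ T₁.r v (e d))
    (w : V) (h : T.r (i v) w) : ∃ v', i v' = w ∧ T₁.r v v' := by
  refine g.T_min (fun w => ∃ v', i v' = w ∧ T₁.r v v') ?_ ?_ _ _ h ⟨v, rfl, T₁.iseqv.refl v⟩
  · rintro v₁ v₂ h1 ⟨v', h2, h3⟩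
    rw [g.inj_i h2] at h3
    exact ⟨v₂, rfl, T₁.iseqv.trans h3 h1⟩
  · rintro u₁ u₂ - ⟨v', h2, h3⟩
    obtain ⟨d, rfl, -⟩ := g.pushout _ _ h2
    exact absurd h3 (hv d)

/-- Components hidden in the glued picture are counted in two steps. -/
theorem ncard_hiddenClasses [Finite V] (g : Gluing i j e e' T₁ R T' T)
    {H₁ F₁ : V₁ → Prop} {H' F' : U → Prop} {H F : V → Prop} (b : Prop)
    (hH₁ : ∀ v, H₁ v ↔ ∀ d, v ≠ e d)
    (hHj : ∀ u, H (j u) ↔ H' u) (hHi : ∀ v, H₁ v → H (i v))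
    (hFi : ∀ v, H₁ v → (F (i v) ↔ F₁ v))
    (hFj : ∀ u, H' u → (F' u ↔ F (j u) ∨
      ∃ d v, u = e' d ∧ T₁.r (e d) v ∧ H₁ v ∧ F₁ v)) :
    (hiddenClasses T H F b).ncard =
      (hiddenClasses T₁ H₁ F₁ b).ncard + (hiddenClasses T' H' F' b).ncard := by
  have hA : {C ∈ hiddenClasses T H F b | ∀ u, j u ∉ C} =
      (fun C => i '' C) '' hiddenClasses T₁ H₁ F₁ b := by
    ext C
    constructor
    · rintro ⟨⟨⟨w, rfl⟩, hH, hF⟩, hj⟩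
      obtain ⟨v, rfl⟩ : ∃ v, i v = w := by
        rcases g.cover w with h | ⟨u, rfl⟩
        · exact h
        · exact absurd (T.iseqv.refl _) (hj u)
      have hv : ∀ d, ¬ T₁.r v (e d) := by
        intro d hd
        refine hj (e' d) ?_
        rw [← g.square]
        exact T.iseqv.symm (g.T_of_T₁ _ _ hd)
      have himg : i '' {v' | T₁.r v' v} = {w | T.r w (i v)} := by
        ext w
        constructor
        · rintro ⟨v', h1, rfl⟩
          exact g.T_of_T₁ _ _ h1
        · intro h
          obtain ⟨v', h1, h2⟩ := g.from_hidden v hv w (T.iseqv.symm h)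
          exact ⟨v', T₁.iseqv.symm h2, h1⟩
      have hh : ∀ v', T₁.r v' v → H₁ v' := by
        intro v' h
        rw [hH₁]
        rintro d rfl
        exact hv d (T₁.iseqv.symm h)
      refine ⟨{v' | T₁.r v' v}, ⟨⟨v, rfl⟩, hh, ?_⟩, himg⟩
      rw [← hF]
      constructor
      · rintro ⟨v', h1, h2⟩
        exact ⟨i v', g.T_of_T₁ _ _ h1, (hFi v' (hh v' h1)).2 h2⟩
      · rintro ⟨w, h1, h2⟩
        obtain ⟨v', h3, rfl⟩ := himg.symm.subset h1
        exact ⟨v', h3, (hFi v' (hh v' h3)).1 h2⟩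
    · rintro ⟨_, ⟨⟨v, rfl⟩, hh, hF⟩, rfl⟩
      have hv : ∀ d, ¬ T₁.r v (e d) := by
        intro d hd
        exact (hH₁ _).1 (hh (e d) (T₁.iseqv.symm hd)) d rfl
      refine ⟨⟨⟨i v, ?_⟩, ?_, ?_⟩, ?_⟩
      · ext w
        constructor
        · rintro ⟨v', h1, rfl⟩
          exact g.T_of_T₁ _ _ h1
        · intro h
          obtain ⟨v', h1, h2⟩ := g.from_hidden v hv w (T.iseqv.symm h)
          exact ⟨v', T₁.iseqv.symm h2, h1⟩
      · rintro _ ⟨v', h1, rfl⟩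
        exact hHi _ (hh _ h1)
      · rw [← hF]
        constructor
        · rintro ⟨_, ⟨v', h1, rfl⟩, h2⟩
          exact ⟨v', h1, (hFi v' (hh v' h1)).1 h2⟩
        · rintro ⟨v', h1, h2⟩
          exact ⟨i v', ⟨v', h1, rfl⟩, (hFi v' (hh v' h1)).2 h2⟩
      · rintro u ⟨v', h1, h2⟩
        obtain ⟨d, rfl, -⟩ := g.pushout _ _ h2
        exact hv d (T₁.iseqv.symm h1)
  -- the flags in a class that meets `U`
  have hflag : ∀ u, (∀ u', T'.r u' u → H' u') →
      ((∃ u', T'.r u' u ∧ F' u') ↔ ∃ w, T.r w (j u) ∧ F w) := by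
    intro u hu
    constructor
    · rintro ⟨u', h1, h2⟩
      rcases (hFj u' (hu u' h1)).1 h2 with h3 | ⟨d, v, rfl, h3, h4, h5⟩
      · exact ⟨j u', (g.T_iff_T' _ _).2 h1, h3⟩
      · refine ⟨i v, ?_, (hFi v h4).2 h5⟩
        refine T.iseqv.trans (T.iseqv.symm (g.T_of_T₁ _ _ h3)) ?_
        rw [g.square]
        exact (g.T_iff_T' _ _).2 h1
    · rintro ⟨w, h1, h2⟩
      have hju : ∀ u', j u' = w → ∃ u', T'.r u' u ∧ F' u' := by
        rintro u' rfl
        have h3 := (g.T_iff_T' _ _).1 h1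
        exact ⟨u', h3, (hFj u' (hu u' h3)).2 (Or.inl h2)⟩
      rcases g.from_U u w (T.iseqv.symm h1) with ⟨u', h3, -⟩ | ⟨v, d, h3, h4, h5⟩
      · exact hju u' h3
      · by_cases hv : H₁ v
        · have h6 := T'.iseqv.symm h5
          refine ⟨e' d, h6, (hFj _ (hu _ h6)).2 (Or.inr ⟨d, v, rfl, T₁.iseqv.symm h4, hv, ?_⟩)⟩
          rw [← hFi v hv, h3]; exact h2
        · rw [hH₁] at hv
          push Not at hv
          obtain ⟨d', rfl⟩ := hv
          exact hju (e' d') (by rw [← g.square, h3])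
  have hhid : ∀ u, (∀ w, T.r w (j u) → H w) ↔ ∀ u', T'.r u' u → H' u' := by
    intro u
    constructor
    · intro h u' hu'
      exact (hHj u').1 (h _ ((g.T_iff_T' _ _).2 hu'))
    · intro h w hw
      rcases g.from_U u w (T.iseqv.symm hw) with ⟨u', rfl, h3⟩ | ⟨v, d, rfl, h4, h5⟩
      · exact (hHj u').2 (h u' (T'.iseqv.symm h3))
      · by_cases hv : H₁ v
        · exact hHi v hv
        · rw [hH₁] at hv
          push Not at hv
          obtain ⟨d', rfl⟩ := hv
          rw [g.square] at hw ⊢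
          exact (hHj _).2 (h _ ((g.T_iff_T' _ _).1 hw))
  have hpre : ∀ u, j ⁻¹' {w | T.r w (j u)} = {u' | T'.r u' u} := by
    intro u
    ext u'
    exact g.T_iff_T' _ _
  have hB : (fun C => j ⁻¹' C) '' {C ∈ hiddenClasses T H F b | ¬ ∀ u, j u ∉ C} =
      hiddenClasses T' H' F' b := by
    ext C'
    constructor
    · rintro ⟨C, ⟨⟨⟨w, rfl⟩, hH, hF⟩, hj⟩, rfl⟩
      push Not at hj
      obtain ⟨u, hu⟩ := hj
      have hcls : {x | T.r x w} = {x | T.r x (j u)} := by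
        ext x
        exact ⟨fun h => T.iseqv.trans h (T.iseqv.symm hu), fun h => T.iseqv.trans h hu⟩
      rw [hcls] at hH hF
      change j ⁻¹' {x | T.r x w} ∈ _
      rw [hcls, hpre]
      have h1 := (hhid u).1 hH
      exact ⟨⟨u, rfl⟩, h1, (hflag u h1).trans hF⟩
    · rintro ⟨⟨u, rfl⟩, hH, hF⟩
      refine ⟨{w | T.r w (j u)}, ⟨⟨⟨j u, rfl⟩, (hhid u).2 hH, (hflag u hH).symm.trans hF⟩, ?_⟩,
        hpre u⟩
      intro h
      exact h u (T.iseqv.refl _)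
  have hsplit : hiddenClasses T H F b = {C ∈ hiddenClasses T H F b | ∀ u, j u ∉ C} ∪
      {C ∈ hiddenClasses T H F b | ¬ ∀ u, j u ∉ C} := by
    ext C
    by_cases h : ∀ u, j u ∉ C
    · simp [h]
    · simp only [Set.mem_union, Set.mem_ofPred_eq, h, and_false, not_false_eq_true, and_true,
        false_or]
  rw [hsplit, Set.ncard_union_eq ?_ (Set.toFinite _) (Set.toFinite _), hA,
    Set.ncard_image_of_injective _ g.inj_i.image_injective, ← hB, Set.InjOn.ncard_image]
  · rintro _ ⟨⟨⟨w, rfl⟩, -, -⟩, h1⟩ _ ⟨⟨⟨w', rfl⟩, -, -⟩, -⟩ h2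
    push Not at h1
    obtain ⟨u, hu⟩ := h1
    have hu' : u ∈ j ⁻¹' {x | T.r x w'} := by
      have h3 : u ∈ j ⁻¹' {x | T.r x w} := hu
      exact h2.subset h3
    ext x
    exact ⟨fun h => T.iseqv.trans h (T.iseqv.trans (T.iseqv.symm hu) hu'),
      fun h => T.iseqv.trans h (T.iseqv.trans (T.iseqv.symm hu') hu)⟩
  · rw [Set.disjoint_left]
    rintro C ⟨-, h1⟩ ⟨-, h2⟩
    exact h2 h1

end Gluing

/-- Vertices on the equator. -/
def Mid : α ⊕ β ⊕ γ → Prop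
  | inr (inl _) => True
  | _ => False

theorem loops_eq (d : PBDiagram α β) (d' : PBDiagram β γ) :
    loops d d' = (hiddenClasses (juxt d d') Mid (MidSingle d d') False).ncard := by
  unfold loops hiddenClasses
  congr 1
  ext C
  refine and_congr_right fun _ => ?_
  constructor
  · intro h
    refine ⟨fun x hx => ?_, iff_false_intro ?_⟩
    · obtain ⟨b, rfl, -⟩ := h x hx
      trivial
    · rintro ⟨x, hx, hs⟩
      obtain ⟨b, rfl, h1, h2⟩ := h x hx
      exact hs.elim h1 h2
  · rintro ⟨h1, h2⟩ (a | b | c) hx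
    · exact (h1 _ hx).elim
    · refine ⟨b, rfl, fun h => h2.1 ⟨_, hx, Or.inl h⟩, fun h => h2.1 ⟨_, hx, Or.inr h⟩⟩
    · exact (h1 _ hx).elim

theorem openStrings_eq (d : PBDiagram α β) (d' : PBDiagram β γ) :
    openStrings d d' = (hiddenClasses (juxt d d') Mid (MidSingle d d') True).ncard := by
  unfold openStrings hiddenClasses
  congr 1
  ext C
  refine and_congr_right fun _ => and_congr ?_ ?_
  · refine forall₂_congr fun x hx => ?_
    rcases x with a | b | c <;> simp [Mid]
  · rw [iff_true]
    constructor
    · rintro ⟨b, hb, h⟩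
      exact ⟨_, hb, h⟩
    · rintro ⟨a | b | c, hx, h⟩
      · exact h.elim
      · exact ⟨b, hx, h⟩
      · exact h.elim

/-- The lines of the concatenation of three diagrams. -/
inductive JuxtRel₃ (d₁ : PBDiagram α β) (d₂ : PBDiagram β γ) (d₃ : PBDiagram γ ε) :
    α ⊕ β ⊕ γ ⊕ ε → α ⊕ β ⊕ γ ⊕ ε → Prop
  | fst (x y : α ⊕ β) (h : d₁.r x y) :
      JuxtRel₃ d₁ d₂ d₃ (Sum.map id inl x) (Sum.map id inl y)
  | snd (x y : β ⊕ γ) (h : d₂.r x y) :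
      JuxtRel₃ d₁ d₂ d₃ (inr (Sum.map id inl x)) (inr (Sum.map id inl y))
  | trd (x y : γ ⊕ ε) (h : d₃.r x y) :
      JuxtRel₃ d₁ d₂ d₃ (inr (inr x)) (inr (inr y))

theorem JuxtRel₃.symm {d₁ : PBDiagram α β} {d₂ : PBDiagram β γ} {d₃ : PBDiagram γ ε}
    {x y : α ⊕ β ⊕ γ ⊕ ε} (h : JuxtRel₃ d₁ d₂ d₃ x y) : JuxtRel₃ d₁ d₂ d₃ y x := by
  cases h with
  | fst x y h => exact .fst _ _ (d₁.iseqv.symm h)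
  | snd x y h => exact .snd _ _ (d₂.iseqv.symm h)
  | trd x y h => exact .trd _ _ (d₃.iseqv.symm h)

/-- The components of the concatenation of three diagrams. -/
def juxt₃ (d₁ : PBDiagram α β) (d₂ : PBDiagram β γ) (d₃ : PBDiagram γ ε) :
    Setoid (α ⊕ β ⊕ γ ⊕ ε) :=
  Relation.EqvGen.setoid (JuxtRel₃ d₁ d₂ d₃)

/-- The inner vertices of the concatenation of three diagrams. -/
def Mid₃ : α ⊕ β ⊕ γ ⊕ ε → Prop
  | inr (inl _) => True
  | inr (inr (inl _)) => True
  | _ => False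

/-- The inner vertices of the concatenation of three diagrams that are singletons of one. -/
def MidSingle₃ (d₁ : PBDiagram α β) (d₂ : PBDiagram β γ) (d₃ : PBDiagram γ ε) :
    α ⊕ β ⊕ γ ⊕ ε → Prop
  | inr (inl b) => d₁.IsSingleton (inr b) ∨ d₂.IsSingleton (inl b)
  | inr (inr (inl c)) => d₂.IsSingleton (inr c) ∨ d₃.IsSingleton (inl c)
  | _ => False

section Assoc

set_option linter.unusedSectionVars false

variable [Finite α] [Finite β] [Finite γ] [Finite ε]
  (d₁ : PBDiagram α β) (d₂ : PBDiagram β γ) (d₃ : PBDiagram γ ε)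

theorem gluing_left : Gluing (Sum.map id (Sum.map id inl) : α ⊕ β ⊕ γ → α ⊕ β ⊕ γ ⊕ ε)
    (Sum.map id inr : α ⊕ γ ⊕ ε → α ⊕ β ⊕ γ ⊕ ε) (Sum.map id inr) (Sum.map id inl)
    (juxt d₁ d₂) (fun u u' => ∃ x x', d₃.r x x' ∧ u = inr x ∧ u' = inr x')
    (juxt (comp d₁ d₂) d₃) (juxt₃ d₁ d₂ d₃) where
  inj_i := .sumMap Function.injective_id (.sumMap Function.injective_id inl_injective)
  inj_j := .sumMap Function.injective_id inr_injective
  square := by rintro (a | c) <;> rfl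
  pushout := by
    rintro (a | b | c) (a' | c' | e') h <;> simp at h
    · exact ⟨inl a, rfl, by rw [h]; rfl⟩
    · exact ⟨inr c, rfl, by rw [h]; rfl⟩
  cover := by
    rintro (a | b | c | e)
    · exact Or.inl ⟨inl a, rfl⟩
    · exact Or.inl ⟨inr (inl b), rfl⟩
    · exact Or.inl ⟨inr (inr c), rfl⟩
    · exact Or.inr ⟨inr (inr e), rfl⟩
  T_of_T₁ := by
    intro v v' h
    refine eqvGen_transport (fun _ _ h => h.symm)
      (fun v' => (juxt₃ d₁ d₂ d₃).r (Sum.map id (Sum.map id inl) v)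
        (Sum.map id (Sum.map id inl) v')) ?_ h ((juxt₃ d₁ d₂ d₃).iseqv.refl _)
    intro x y hxy hx
    refine (juxt₃ d₁ d₂ d₃).iseqv.trans hx (.rel _ _ ?_)
    cases hxy with
    | left x y h =>
      have := JuxtRel₃.fst (d₂ := d₂) (d₃ := d₃) x y h
      rcases x with x | x <;> rcases y with y | y <;> exact this
    | right x y h => exact .snd x y h
  T_of_R := by
    rintro _ _ ⟨x, x', h, rfl, rfl⟩
    exact .rel _ _ (.trd x x' h)
  T_min := by
    intro P h1 h2 w w' h
    refine eqvGen_transport (fun _ _ h => h.symm) P ?_ h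
    intro x y hxy
    cases hxy with
    | fst x y h =>
      have := h1 _ _ (.rel _ _ (.left x y h))
      rcases x with x | x <;> rcases y with y | y <;> exact this
    | snd x y h => exact h1 _ _ (.rel _ _ (.right x y h))
    | trd x y h => exact h2 _ _ ⟨x, y, h, rfl, rfl⟩
  T'_of_T₁ := fun x y h => .rel _ _ (.left x y h)
  T'_of_R := by
    rintro _ _ ⟨x, x', h, rfl, rfl⟩
    exact .rel _ _ (.right x x' h)
  T'_min := by
    intro P h1 h2 w w' h
    refine eqvGen_transport (fun _ _ h => h.symm) P ?_ h
    intro x y hxy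
    cases hxy with
    | left x y h => exact h1 x y h
    | right x y h => exact h2 _ _ ⟨x, y, h, rfl, rfl⟩

theorem gluing_right : Gluing (inr : β ⊕ γ ⊕ ε → α ⊕ β ⊕ γ ⊕ ε)
    (Sum.map id (Sum.map id inr) : α ⊕ β ⊕ ε → α ⊕ β ⊕ γ ⊕ ε) (Sum.map id inr) inr
    (juxt d₂ d₃)
    (fun u u' => ∃ x x', d₁.r x x' ∧ u = Sum.map id inl x ∧ u' = Sum.map id inl x')
    (juxt d₁ (comp d₂ d₃)) (juxt₃ d₁ d₂ d₃) where
  inj_i := inr_injective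
  inj_j := .sumMap Function.injective_id (.sumMap Function.injective_id inr_injective)
  square := by rintro (a | c) <;> rfl
  pushout := by
    rintro (b | c | e) (a' | b' | e') h <;> simp at h
    · exact ⟨inl b, rfl, by rw [h]⟩
    · exact ⟨inr e, rfl, by rw [h]⟩
  cover := by
    rintro (a | b | c | e)
    · exact Or.inr ⟨inl a, rfl⟩
    · exact Or.inl ⟨inl b, rfl⟩
    · exact Or.inl ⟨inr (inl c), rfl⟩
    · exact Or.inl ⟨inr (inr e), rfl⟩
  T_of_T₁ := by
    intro v v' h
    refine eqvGen_transport (fun _ _ h => h.symm)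
      (fun v' => (juxt₃ d₁ d₂ d₃).r (inr v) (inr v')) ?_ h ((juxt₃ d₁ d₂ d₃).iseqv.refl _)
    intro x y hxy hx
    refine (juxt₃ d₁ d₂ d₃).iseqv.trans hx (.rel _ _ ?_)
    cases hxy with
    | left x y h => exact .snd x y h
    | right x y h => exact .trd x y h
  T_of_R := by
    rintro _ _ ⟨x, x', h, rfl, rfl⟩
    have := JuxtRel₃.fst (d₂ := d₂) (d₃ := d₃) x x' h
    refine .rel _ _ ?_
    rcases x with x | x <;> rcases x' with y | y <;> exact this
  T_min := by
    intro P h1 h2 w w' h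
    refine eqvGen_transport (fun _ _ h => h.symm) P ?_ h
    intro x y hxy
    cases hxy with
    | fst x y h =>
      have := h2 _ _ ⟨x, y, h, rfl, rfl⟩
      rcases x with x | x <;> rcases y with y | y <;> exact this
    | snd x y h => exact h1 _ _ (.rel _ _ (.left x y h))
    | trd x y h => exact h1 _ _ (.rel _ _ (.right x y h))
  T'_of_T₁ := fun x y h => .rel _ _ (.right x y h)
  T'_of_R := by
    rintro _ _ ⟨x, x', h, rfl, rfl⟩
    exact .rel _ _ (.left x x' h)
  T'_min := by
    intro P h1 h2 w w' h
    refine eqvGen_transport (fun _ _ h => h.symm) P ?_ h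
    intro x y hxy
    cases hxy with
    | left x y h => exact h2 _ _ ⟨x, y, h, rfl, rfl⟩
    | right x y h => exact h1 x y h

theorem ncard_left (b : Prop) :
    (hiddenClasses (juxt₃ d₁ d₂ d₃) Mid₃ (MidSingle₃ d₁ d₂ d₃) b).ncard =
      (hiddenClasses (juxt d₁ d₂) Mid (MidSingle d₁ d₂) b).ncard +
      (hiddenClasses (juxt (comp d₁ d₂) d₃) Mid (MidSingle (comp d₁ d₂) d₃) b).ncard := by
  refine (gluing_left d₁ d₂ d₃).ncard_hiddenClasses b ?_ ?_ ?_ ?_ ?_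
  · rintro (a | b | c) <;> simp [Mid]
  · rintro (a | c | e) <;> simp [Mid, Mid₃]
  · rintro (a | b | c) <;> simp [Mid, Mid₃]
  · rintro (a | b | c) <;> simp [Mid, MidSingle, MidSingle₃]
  · rintro (a | c | e) h
    · exact h.elim
    · change (comp d₁ d₂).IsSingleton (inr c) ∨ d₃.IsSingleton (inl c) ↔
        (d₂.IsSingleton (inr c) ∨ d₃.IsSingleton (inl c)) ∨ _
      rw [comp_isSingleton]
      constructor
      · rintro ((h1 | ⟨v, h1, h2⟩) | h1)
        · exact Or.inl (Or.inl h1)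
        · refine Or.inr ⟨inr c, v, rfl, h1, ?_, h2⟩
          rcases v with a | b | c
          · exact h2
          · trivial
          · exact h2
        · exact Or.inl (Or.inr h1)
      · rintro ((h1 | h1) | ⟨(a | c'), v, h0, h1, -, h2⟩)
        · exact Or.inl (Or.inl h1)
        · exact Or.inr h1
        · simp at h0
        · simp only [Sum.map_inr, inr.injEq, inl.injEq] at h0
          subst h0
          exact Or.inl (Or.inr ⟨v, h1, h2⟩)
    · exact h.elim

theorem ncard_right (b : Prop) :
    (hiddenClasses (juxt₃ d₁ d₂ d₃) Mid₃ (MidSingle₃ d₁ d₂ d₃) b).ncard =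
      (hiddenClasses (juxt d₂ d₃) Mid (MidSingle d₂ d₃) b).ncard +
      (hiddenClasses (juxt d₁ (comp d₂ d₃)) Mid (MidSingle d₁ (comp d₂ d₃)) b).ncard := by
  refine (gluing_right d₁ d₂ d₃).ncard_hiddenClasses b ?_ ?_ ?_ ?_ ?_
  · rintro (a | b | c) <;> simp [Mid]
  · rintro (a | c | e) <;> simp [Mid, Mid₃]
  · rintro (a | b | c) <;> simp [Mid, Mid₃]
  · rintro (a | b | c) <;> simp [Mid, MidSingle, MidSingle₃]
  · rintro (a | b | e) h
    · exact h.elim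
    · change d₁.IsSingleton (inr b) ∨ (comp d₂ d₃).IsSingleton (inl b) ↔
        (d₁.IsSingleton (inr b) ∨ d₂.IsSingleton (inl b)) ∨ _
      rw [comp_isSingleton]
      constructor
      · rintro (h1 | (h1 | ⟨v, h1, h2⟩))
        · exact Or.inl (Or.inl h1)
        · exact Or.inl (Or.inr h1)
        · refine Or.inr ⟨inl b, v, rfl, h1, ?_, h2⟩
          rcases v with a | b | c
          · exact h2
          · trivial
          · exact h2
      · rintro ((h1 | h1) | ⟨(b' | c'), v, h0, h1, -, h2⟩)
        · exact Or.inl h1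
        · exact Or.inr (Or.inl h1)
        · simp only [inr.injEq, inl.injEq] at h0
          subst h0
          exact Or.inr (Or.inr ⟨v, h1, h2⟩)
        · simp at h0
    · exact h.elim

theorem comp_assoc : comp (comp d₁ d₂) d₃ = comp d₁ (comp d₂ d₃) := by
  apply PairPartition.ext
  funext x y
  refine propext (Iff.trans ((gluing_left d₁ d₂ d₃).T_iff_T' _ _).symm
    (Iff.trans ?_ ((gluing_right d₁ d₂ d₃).T_iff_T' _ _)))
  rcases x with x | x <;> rcases y with y | y <;> exact Iff.rfl

theorem loops_assoc : loops d₁ d₂ + loops (comp d₁ d₂) d₃ =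
    loops d₂ d₃ + loops d₁ (comp d₂ d₃) := by
  simp only [loops_eq]
  rw [← ncard_left, ← ncard_right]

theorem openStrings_assoc : openStrings d₁ d₂ + openStrings (comp d₁ d₂) d₃ =
    openStrings d₂ d₃ + openStrings d₁ (comp d₂ d₃) := by
  simp only [openStrings_eq]
  rw [← ncard_left, ← ncard_right]

end Assoc

/-! ### Unit laws -/

section Unit

theorem juxt_one_left (d : PBDiagram α β) (x y : α ⊕ α ⊕ β) :
    (juxt (one α) d).r x y ↔ d.r (Sum.elim inl id x) (Sum.elim inl id y) := by
  have h1 : ∀ x : α ⊕ α ⊕ β, (juxt (one α) d).r x (inr (Sum.elim inl id x)) := by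
    rintro (a | x)
    · exact .rel _ _ (.left (inl a) (inr a) rfl)
    · exact .refl _
  constructor
  · intro h
    refine eqvGen_transport (fun _ _ h => h.symm)
      (fun y => d.r (Sum.elim inl id x) (Sum.elim inl id y)) ?_ h (d.iseqv.refl _)
    intro u v huv hu
    refine d.iseqv.trans hu ?_
    cases huv with
    | left u v h =>
      have h' : Sum.elim id id u = Sum.elim id id v := h
      rcases u with u | u <;> rcases v with v | v <;>
        (simp at h'; subst h'; exact d.iseqv.refl _)
    | right u v h => exact h
  · intro h
    exact (juxt (one α) d).iseqv.trans (h1 x) ((juxt (one α) d).iseqv.trans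
      (.rel _ _ (.right _ _ h)) ((juxt (one α) d).iseqv.symm (h1 y)))

theorem juxt_one_right (d : PBDiagram α β) (x y : α ⊕ β ⊕ β) :
    (juxt d (one β)).r x y ↔ d.r (Sum.map id (Sum.elim id id) x) (Sum.map id (Sum.elim id id) y) := by
  have h1 : ∀ x : α ⊕ β ⊕ β, (juxt d (one β)).r x
      (Sum.map id inl (Sum.map id (Sum.elim id id) x : α ⊕ β)) := by
    rintro (a | b | b)
    · exact .refl _
    · exact .refl _
    · exact .rel _ _ (.right (inr b) (inl b) rfl)
  constructor
  · intro h
    refine eqvGen_transport (fun _ _ h => h.symm)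
      (fun y => d.r (Sum.map id (Sum.elim id id) x) (Sum.map id (Sum.elim id id) y)) ?_ h
      (d.iseqv.refl _)
    intro u v huv hu
    refine d.iseqv.trans hu ?_
    cases huv with
    | left u v h => rcases u with u | u <;> rcases v with v | v <;> exact h
    | right u v h =>
      have h' : Sum.elim id id u = Sum.elim id id v := h
      change d.r (inr (Sum.elim id id u)) (inr (Sum.elim id id v))
      rw [h']
  · intro h
    exact (juxt d (one β)).iseqv.trans (h1 x) ((juxt d (one β)).iseqv.trans
      (.rel _ _ (.left _ _ h)) ((juxt d (one β)).iseqv.symm (h1 y)))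

theorem one_comp [Finite α] [Finite β] (d : PBDiagram α β) : comp (one α) d = d := by
  apply PairPartition.ext
  funext x y
  refine propext ((juxt_one_left d _ _).trans ?_)
  rcases x with x | x <;> rcases y with y | y <;> exact Iff.rfl

theorem comp_one [Finite α] [Finite β] (d : PBDiagram α β) : comp d (one β) = d := by
  apply PairPartition.ext
  funext x y
  refine propext ((juxt_one_right d _ _).trans ?_)
  rcases x with x | x <;> rcases y with y | y <;> exact Iff.rfl

theorem hiddenClasses_one_left (d : PBDiagram α β) (F : α ⊕ α ⊕ β → Prop) (b : Prop) :
    (hiddenClasses (juxt (one α) d) Mid F b).ncard = 0 := by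
  have : hiddenClasses (juxt (one α) d) Mid F b = ∅ := by
    rw [Set.eq_empty_iff_forall_notMem]
    rintro _ ⟨⟨x, rfl⟩, h, -⟩
    rcases x with a | a | c
    · exact h _ ((juxt (one α) d).iseqv.refl _)
    · exact h (inl a) ((juxt_one_left d _ _).2 (d.iseqv.refl _))
    · exact h _ ((juxt (one α) d).iseqv.refl _)
  rw [this, Set.ncard_empty]

theorem hiddenClasses_one_right (d : PBDiagram α β) (F : α ⊕ β ⊕ β → Prop) (b : Prop) :
    (hiddenClasses (juxt d (one β)) Mid F b).ncard = 0 := by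
  have : hiddenClasses (juxt d (one β)) Mid F b = ∅ := by
    rw [Set.eq_empty_iff_forall_notMem]
    rintro _ ⟨⟨x, rfl⟩, h, -⟩
    rcases x with a | a | c
    · exact h _ ((juxt d (one β)).iseqv.refl _)
    · exact h (inr (inr a)) ((juxt_one_right d _ _).2 (d.iseqv.refl _))
    · exact h _ ((juxt d (one β)).iseqv.refl _)
  rw [this, Set.ncard_empty]

end Unit

/-- Partial Brauer diagrams form a monoid under `∘`. -/
instance [Finite α] : Monoid (PBDiagram α α) where
  mul := comp
  one := one α
  mul_assoc := comp_assoc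
  one_mul := one_comp
  mul_one := comp_one

theorem mul_def [Finite α] (d d' : PBDiagram α α) : d * d' = comp d d' := rfl

theorem one_def [Finite α] : (1 : PBDiagram α α) = one α := rfl

/-- Brauer diagrams: partitions into pairs, i.e. partial Brauer diagrams without singletons. -/
def brauer (α : Type*) [Finite α] : Submonoid (PBDiagram α α) where
  carrier := {d | ∀ x, ¬ d.IsSingleton x}
  mul_mem' := by
    intro d d' hd hd' x hx
    rcases (comp_isSingleton d d' x).1 hx with h | ⟨v, -, h⟩
    · rcases x with a | c
      · exact hd _ h
      · exact hd' _ h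
    · rcases v with a | b | c
      · exact h
      · exact h.elim (hd _) (hd' _)
      · exact h
  one_mem' := by
    rintro (a | a) h
    · exact absurd (h (inr a) rfl) (by simp)
    · exact absurd (h (inl a) rfl) (by simp)

end PBDiagram

/-! ### Twisted monoid algebras -/

/-- A normalized `2`-cocycle on a monoid `M` with values in the multiplicative monoid of `𝕜`. -/
structure MonoidCocycle (M 𝕜 : Type*) [Monoid M] [CommRing 𝕜] where
  toFun : M → M → 𝕜
  one_left : ∀ x, toFun 1 x = 1
  one_right : ∀ x, toFun x 1 = 1
  assoc : ∀ x y z, toFun x y * toFun (x * y) z = toFun y z * toFun x (y * z)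

/-- The free `𝕜`-module with basis `M`, with the multiplication that is determined on basis
elements by `x · y = c(x,y) (x * y)`. -/
def TwistedMonoidAlgebra {M 𝕜 : Type*} [Monoid M] [CommRing 𝕜] (_c : MonoidCocycle M 𝕜) :
    Type _ :=
  M →₀ 𝕜

namespace TwistedMonoidAlgebra

variable {M 𝕜 : Type*} [Monoid M] [CommRing 𝕜] (c : MonoidCocycle M 𝕜)

noncomputable instance : AddCommGroup (TwistedMonoidAlgebra c) :=
  inferInstanceAs (AddCommGroup (M →₀ 𝕜))

noncomputable instance : Module 𝕜 (TwistedMonoidAlgebra c) :=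
  inferInstanceAs (Module 𝕜 (M →₀ 𝕜))

/-- The standard basis. -/
noncomputable def basis : Module.Basis M 𝕜 (TwistedMonoidAlgebra c) :=
  Module.Basis.ofRepr (LinearEquiv.refl 𝕜 (M →₀ 𝕜))

/-- The multiplication as a bilinear map. -/
noncomputable def mulBilin : TwistedMonoidAlgebra c →ₗ[𝕜] TwistedMonoidAlgebra c →ₗ[𝕜]
    TwistedMonoidAlgebra c :=
  (basis c).constr 𝕜 fun x => (basis c).constr 𝕜 fun y => c.toFun x y • basis c (x * y)

theorem mulBilin_basis (x y : M) :
    mulBilin c (basis c x) (basis c y) = c.toFun x y • basis c (x * y) := by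
  simp [mulBilin]

theorem mulBilin_assoc (f g h : TwistedMonoidAlgebra c) :
    mulBilin c (mulBilin c f g) h = mulBilin c f (mulBilin c g h) := by
  have h1 : ∀ x y h, mulBilin c (mulBilin c (basis c x) (basis c y)) h =
      mulBilin c (basis c x) (mulBilin c (basis c y) h) := by
    intro x y h
    refine LinearMap.congr_fun (f := mulBilin c (mulBilin c (basis c x) (basis c y)))
      (g := mulBilin c (basis c x) ∘ₗ mulBilin c (basis c y)) ?_ h
    refine (basis c).ext fun z => ?_
    rw [LinearMap.comp_apply, mulBilin_basis, mulBilin_basis, map_smul, map_smul,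
      LinearMap.smul_apply, mulBilin_basis, mulBilin_basis, smul_smul, smul_smul, c.assoc,
      mul_assoc]
  have h2 : ∀ x g h, mulBilin c (mulBilin c (basis c x) g) h =
      mulBilin c (basis c x) (mulBilin c g h) := by
    intro x g h
    refine LinearMap.congr_fun (f := (mulBilin c).flip h ∘ₗ mulBilin c (basis c x))
      (g := mulBilin c (basis c x) ∘ₗ (mulBilin c).flip h) ?_ g
    exact (basis c).ext fun y => h1 x y h
  refine LinearMap.congr_fun (f := (mulBilin c).flip h ∘ₗ (mulBilin c).flip g)
    (g := (mulBilin c).flip (mulBilin c g h)) ?_ f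
  exact (basis c).ext fun x => h2 x g h

theorem one_mulBilin (f : TwistedMonoidAlgebra c) : mulBilin c (basis c 1) f = f := by
  refine LinearMap.congr_fun (f := mulBilin c (basis c 1)) (g := LinearMap.id) ?_ f
  refine (basis c).ext fun x => ?_
  rw [mulBilin_basis, c.one_left, one_smul, one_mul, LinearMap.id_apply]

theorem mulBilin_one (f : TwistedMonoidAlgebra c) : mulBilin c f (basis c 1) = f := by
  refine LinearMap.congr_fun (f := (mulBilin c).flip (basis c 1)) (g := LinearMap.id) ?_ f
  refine (basis c).ext fun x => ?_
  rw [LinearMap.flip_apply, mulBilin_basis, c.one_right, one_smul, mul_one, LinearMap.id_apply]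

noncomputable instance : Ring (TwistedMonoidAlgebra c) where
  __ := (inferInstance : AddCommGroup (TwistedMonoidAlgebra c))
  mul f g := mulBilin c f g
  one := basis c 1
  mul_assoc := mulBilin_assoc c
  one_mul := one_mulBilin c
  mul_one := mulBilin_one c
  zero_mul f := LinearMap.map_zero₂ (mulBilin c) f
  mul_zero f := map_zero (mulBilin c f)
  left_distrib f g h := map_add (mulBilin c f) g h
  right_distrib f g h := LinearMap.map_add₂ (mulBilin c) f g h

noncomputable instance : Algebra 𝕜 (TwistedMonoidAlgebra c) :=
  Algebra.ofModule (fun r f g => LinearMap.map_smul₂ (mulBilin c) r f g)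
    (fun r f g => map_smul (mulBilin c f) r g)

end TwistedMonoidAlgebra

/-! ### The algebras -/

section Algebras

variable {𝕜 : Type*} [CommRing 𝕜]

open PBDiagram

/-- The straightening factor `δ ^ k * δ' ^ k'` of `d|d'`, where `k` is the number of closed loops
and `k'` the number of open strings. -/
noncomputable def partialBrauerCocycle (n : ℕ) (δ δ' : 𝕜) :
    MonoidCocycle (PBDiagram (Fin n) (Fin n)) 𝕜 where
  toFun d d' := δ ^ loops d d' * δ' ^ openStrings d d'
  one_left d := by
    rw [loops_eq, openStrings_eq, one_def, hiddenClasses_one_left, hiddenClasses_one_left,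
      pow_zero, pow_zero, one_mul]
  one_right d := by
    rw [loops_eq, openStrings_eq, one_def, hiddenClasses_one_right, hiddenClasses_one_right,
      pow_zero, pow_zero, one_mul]
  assoc x y z := by
    rw [mul_mul_mul_comm, ← pow_add, ← pow_add, mul_def, mul_def, loops_assoc,
      openStrings_assoc, pow_add, pow_add, mul_mul_mul_comm]

/-- The partial Brauer algebra `R_n(δ, δ')`: the basis consists of the partitions of
`{1, …, n, 1', …, n'}` into pairs and singletons, and `d d' = δ ^ k δ' ^ k' (d ∘ d')`. -/
abbrev PartialBrauerAlgebra (n : ℕ) (δ δ' : 𝕜) :=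
  TwistedMonoidAlgebra (partialBrauerCocycle n δ δ')

/-- The straightening factor `δ ^ k` of the concatenation of two Brauer diagrams, where `k` is the
number of closed loops. -/
noncomputable def brauerCocycle (n : ℕ) (δ : 𝕜) : MonoidCocycle (brauer (Fin n)) 𝕜 where
  toFun d d' := δ ^ loops d.1 d'.1
  one_left d := by
    rw [loops_eq, Submonoid.coe_one, one_def, hiddenClasses_one_left, pow_zero]
  one_right d := by
    rw [loops_eq, Submonoid.coe_one, one_def, hiddenClasses_one_right, pow_zero]
  assoc x y z := by
    rw [← pow_add, ← pow_add, Submonoid.coe_mul, Submonoid.coe_mul, mul_def, mul_def, loops_assoc]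

/-- The Brauer algebra `B_n(δ)`: the basis consists of the partitions of `{1, …, n, 1', …, n'}`
into pairs, and `d d' = δ ^ k (d ∘ d')`. -/
abbrev BrauerAlgebra (n : ℕ) (δ : 𝕜) :=
  TwistedMonoidAlgebra (brauerCocycle n δ)

end Algebras

/-! Write $s(d)$ for the number of singletons of $d$. Every singleton of $d$ or $d'$ is an end of a
component of $d|d'$. An open string has two such ends, a component through an outer vertex has one
if that vertex becomes a singleton of $d\circ d'$ and none otherwise. Hence $s(d)+s(d')=2k'+s(d\circ
d')$ (`numSingletons_add`), and since $s$ is even, rescaling $d$ by the unit $\delta'^{s(d)/2}$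
replaces $\delta'$ by 1.

Now read each line as a sum of two things: a "pure" line and the same line cut into two singletons.
Thus $d$ is sent to the sum of its refinements $e\le d$, which is a unitriangular change of basis.
In the new basis `pureBasis` a product vanishes unless the right support of the first factor equals
the left support of the second, and a loop contributes $\delta-1$. The reason is that matching pairs
of refinements of $d,d'$ with a fixed composite correspond to subsets $L$ of the loops of $d|d'$,
and $\sum_L(\delta-1)^{|L|}=\delta^k$ (`sum_matches_pow_loops`, `refinementSum_mul`).

The identity becomes a sum of orthogonal idempotents $e_S$, one for each set $S$ of vertices (the
basis vector of `idOn S`), and $e_SRe_S$ is a Brauer algebra on $|S|$ points with parameter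
$\delta-1$. Take $e=e_S+e_T$ with $S$ everything and $T$ everything but the last point. There are no
mixed terms, since a diagram with supports $S$ and $T$ would have exactly one singleton, against
parity. So $eRe\cong\mathfrak{B}_n(\delta-1)\times\mathfrak{B}_{n-1}(\delta-1)$
(`exists_ofBrauerProd_eq`).

The corner is full: adding an arc shows that $(\delta-1)^l e_S$, for some $l$, lies in the ideal of
$e_{S\cup\{i,j\}}$, and transpositions identify the sets with one point missing (`idOn_mem`). As
$\delta-1$ is a unit, $ReR=R$, and a full corner is Morita equivalent to the whole algebra
(`IsMoritaEquivalent.of_full_corner`). -/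

/-! ### Morita equivalence with a full corner -/

section FullCorner

open CategoryTheory

universe v u

variable {𝕜 : Type v} {R S : Type u} [CommRing 𝕜] [Ring R] [Ring S] [Algebra 𝕜 R] [Algebra 𝕜 S]

/-- The part `e M` of an `R`-module `M` that is cut out by the idempotent `e = φ 1`. -/
def cornerPart (φ : S →ₙₐ[𝕜] R) (M : Type*) [AddCommGroup M] [Module R M] : AddSubgroup M where
  carrier := {m | φ 1 • m = m}
  add_mem' := fun {a b} ha hb => by
    change φ 1 • (a + b) = a + b
    rw [smul_add, ha, hb]
  zero_mem' := smul_zero _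
  neg_mem' := fun {a} ha => by
    change φ 1 • (-a) = -a
    rw [smul_neg, ha]

theorem mem_cornerPart {φ : S →ₙₐ[𝕜] R} {M : Type*} [AddCommGroup M] [Module R M] {m : M} :
    m ∈ cornerPart φ M ↔ φ 1 • m = m := Iff.rfl

theorem smul_mem_cornerPart (φ : S →ₙₐ[𝕜] R) {M : Type*} [AddCommGroup M] [Module R M] (s : S)
    (m : M) : φ s • m ∈ cornerPart φ M := by
  rw [mem_cornerPart, smul_smul, ← map_mul, one_mul]

instance (φ : S →ₙₐ[𝕜] R) (M : Type*) [AddCommGroup M] [Module R M] :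
    Module S (cornerPart φ M) where
  smul s m := ⟨φ s • m.1, smul_mem_cornerPart φ s m.1⟩
  one_smul m := Subtype.ext m.2
  mul_smul s t m := Subtype.ext (by
    change φ (s * t) • m.1 = φ s • φ t • m.1
    rw [map_mul, mul_smul])
  smul_zero s := Subtype.ext (smul_zero _)
  smul_add s m m' := Subtype.ext (smul_add _ _ _)
  add_smul s t m := Subtype.ext (by
    change φ (s + t) • m.1 = φ s • m.1 + φ t • m.1
    rw [map_add, add_smul])
  zero_smul m := Subtype.ext (by
    change φ 0 • m.1 = 0
    rw [map_zero, zero_smul])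

theorem coe_smul_cornerPart (φ : S →ₙₐ[𝕜] R) (M : Type*) [AddCommGroup M] [Module R M] (s : S)
    (m : cornerPart φ M) : ((s • m : cornerPart φ M) : M) = φ s • m.1 := rfl

/-- The restriction of an `R`-linear map to the parts cut out by `φ 1`. -/
def cornerMap (φ : S →ₙₐ[𝕜] R) {M N : Type*} [AddCommGroup M] [Module R M] [AddCommGroup N]
    [Module R N] (f : M →ₗ[R] N) : cornerPart φ M →ₗ[S] cornerPart φ N where
  toFun m := ⟨f m.1, by rw [mem_cornerPart, ← map_smul, m.2]⟩
  map_add' m m' := Subtype.ext (map_add f _ _)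
  map_smul' s m := Subtype.ext (map_smul f _ _)

/-- The functor `M ↦ e M`. -/
def cornerFunctor (φ : S →ₙₐ[𝕜] R) : ModuleCat.{u} R ⥤ ModuleCat.{u} S where
  obj M := ModuleCat.of S (cornerPart φ M)
  map f := ModuleCat.ofHom (cornerMap φ f.hom)
  map_id _ := rfl
  map_comp _ _ := rfl

/-- The additive maps `R → N` that are compatible with the left action of `S`; a model of
`Hom_S (eR, N)`. -/
def cornerHom (φ : S →ₙₐ[𝕜] R) (N : Type*) [AddCommGroup N] [Module S N] :
    AddSubgroup (R →+ N) where
  carrier := {ψ | ∀ s r, ψ (φ s * r) = s • ψ r}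
  add_mem' := fun {a b} ha hb s r => by
    rw [AddMonoidHom.add_apply, AddMonoidHom.add_apply, ha s r, hb s r, smul_add]
  zero_mem' := fun s r => by simp
  neg_mem' := fun {a} ha s r => by
    rw [AddMonoidHom.neg_apply, AddMonoidHom.neg_apply, ha s r, smul_neg]

/-- $R$ acts by right multiplication in the argument, which commutes with the left equivariance
under $S$ and so gives a left action. -/
instance (φ : S →ₙₐ[𝕜] R) (N : Type*) [AddCommGroup N] [Module S N] :
    Module R (cornerHom φ N) where
  smul r ψ := ⟨ψ.1.comp (AddMonoidHom.mulRight r), fun s x => by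
    change ψ.1 (φ s * x * r) = s • ψ.1 (x * r)
    rw [mul_assoc, ψ.2]⟩
  one_smul ψ := Subtype.ext (AddMonoidHom.ext fun x => congrArg ψ.1 (mul_one x))
  mul_smul r t ψ := Subtype.ext (AddMonoidHom.ext fun x =>
    congrArg ψ.1 (mul_assoc x r t).symm)
  smul_zero r := rfl
  smul_add r ψ ψ' := rfl
  add_smul r t ψ := Subtype.ext (AddMonoidHom.ext fun x =>
    (congrArg ψ.1 (mul_add x r t)).trans (map_add ψ.1 _ _))
  zero_smul ψ := Subtype.ext (AddMonoidHom.ext fun x =>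
    (congrArg ψ.1 (mul_zero x)).trans (map_zero ψ.1))

/-- The counit $e\,\mathrm{Hom}_S(eR,N)=\mathrm{Hom}_S(eRe,N)=\mathrm{Hom}_S(S,N)=N$, given by
evaluation at 1. The inverse uses the map $c:R\to S$ with $\varphi(c(x))=exe$. All properties of $c$
follow from the injectivity of $\varphi$. -/
theorem exists_cornerPart_cornerHom_equiv (φ : S →ₙₐ[𝕜] R) (hinj : Function.Injective φ)
    (hcorner : ∀ r, ∃ s, φ s = φ 1 * r * φ 1) (N : Type*) [AddCommGroup N] [Module S N] :
    Nonempty (cornerPart φ (cornerHom φ N) ≃ₗ[S] N) := by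
  choose c hc using hcorner
  have hee : φ 1 * φ 1 = φ 1 := by rw [← map_mul, one_mul]
  have hc_add : ∀ x y, c (x + y) = c x + c y := fun x y => hinj (by
    rw [map_add, hc, hc, hc, mul_add, add_mul])
  have hc_mul : ∀ s x, c (φ s * x) = s * c x := fun s x => hinj (by
    rw [map_mul, hc, hc]
    simp only [← mul_assoc]
    rw [← map_mul, ← map_mul, one_mul, mul_one])
  have hc_one : c 1 = 1 := hinj (by rw [hc, mul_one, hee])
  have hc_right : ∀ x, c (x * φ 1) = c x := fun x => hinj (by
    rw [hc, hc]; simp only [mul_assoc]; rw [hee])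
  -- Being fixed by $e$ means $\psi(xe)=\psi(x)$. Together with equivariance this gives
  -- $\psi(x)=\psi(exe)=c(x)\psi(1)$.
  have hfix : ∀ (ψ : cornerPart φ (cornerHom φ N)) x, ψ.1.1 (x * φ 1) = ψ.1.1 x :=
    fun ψ x => DFunLike.congr_fun (congrArg Subtype.val ψ.2) x
  refine ⟨{ toFun := fun ψ => ψ.1.1 1
            map_add' := fun _ _ => rfl
            map_smul' := fun s ψ => ?_
            invFun := fun n => ⟨⟨AddMonoidHom.mk' (fun x => c x • n) fun x y => ?_, ?_⟩, ?_⟩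
            left_inv := fun ψ => ?_
            right_inv := fun n => ?_ }⟩
  · change ψ.1.1 (1 * φ s) = s • ψ.1.1 1
    rw [one_mul, ← ψ.1.2, mul_one]
  · rw [hc_add, add_smul]
  · intro s x
    change c (φ s * x) • n = s • c x • n
    rw [hc_mul, mul_smul]
  · refine Subtype.ext (AddMonoidHom.ext fun x => ?_)
    change c (x * φ 1) • n = c x • n
    rw [hc_right]
  · refine Subtype.ext (Subtype.ext (AddMonoidHom.ext fun x => ?_))
    change c x • ψ.1.1 1 = ψ.1.1 x
    rw [← ψ.1.2, hc, mul_one, hfix, ψ.1.2, one_smul]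
  · change c 1 • n = n
    rw [hc_one, one_smul]

open scoped ModuleCat.Algebra in
/-- Morita equivalence with a full corner: if `φ` identifies `S` with `e R e`, where `e = φ 1`
satisfies `R e R = R`, then `R` and `S` are Morita equivalent. -/
theorem IsMoritaEquivalent.of_full_corner (φ : S →ₙₐ[𝕜] R) (hinj : Function.Injective φ)
    (hcorner : ∀ r, ∃ s, φ s = φ 1 * r * φ 1)
    (hfull : (1 : R) ∈ Submodule.span 𝕜 (Set.range fun p : R × R => p.1 * φ 1 * p.2)) :
    IsMoritaEquivalent 𝕜 R S := by
  -- Fullness as a finite identity $1=\sum_i a_i e b_i$, with the scalars of the linear combination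
  -- absorbed into the $a_i$. Every $m$ is then $\sum_i a_i(e b_i m)$, so a module is controlled by
  -- its $e$-part.
  obtain ⟨ι, _, a, b, hab⟩ : ∃ (ι : Type u) (_ : Fintype ι) (a b : ι → R),
      ∑ i, a i * φ 1 * b i = 1 := by
    obtain ⟨c, hc⟩ := Finsupp.mem_span_range_iff_exists_finsupp.1 hfull
    refine ⟨c.support, inferInstance, fun i => c i.1 • i.1.1, fun i => i.1.2, ?_⟩
    rw [← hc, Finsupp.sum, ← Finset.sum_coe_sort c.support]
    simp only [smul_mul_assoc]
  have hee : φ 1 * φ 1 = φ 1 := by rw [← map_mul, one_mul]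
  have hexp : ∀ (M : ModuleCat.{u} R) (m : M), ∑ i, a i • φ 1 • b i • m = m := by
    intro M m
    simp only [smul_smul, ← Finset.sum_smul, hab, one_smul, ← mul_assoc]
  have hmem : ∀ (M : ModuleCat.{u} R) (m : M), φ 1 • m ∈ cornerPart φ M := fun M m =>
    smul_mem_cornerPart φ 1 m
  have hfaithful : (cornerFunctor φ).Faithful := by
    constructor
    intro M N f g hfg
    ext m
    have h1 : ∀ m : M, f.hom (φ 1 • m) = g.hom (φ 1 • m) := fun m =>
      congrArg Subtype.val (LinearMap.congr_fun (congrArg ModuleCat.Hom.hom hfg) ⟨_, hmem M m⟩)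
    rw [← hexp M m, map_sum, map_sum]
    refine Finset.sum_congr rfl fun i _ => ?_
    rw [map_smul f.hom (a i), map_smul g.hom (a i), h1]
  have hfullF : (cornerFunctor φ).Full := by
    constructor
    intro M N h
    let k : cornerPart φ M →ₗ[S] cornerPart φ N := h.hom
    let l : M → cornerPart φ M := fun m => ⟨φ 1 • m, hmem M m⟩
    have hl_add : ∀ m m', l (m + m') = l m + l m' := fun m m' => Subtype.ext (smul_add _ _ _)
    have hl_sum : ∀ m : ι → M, l (∑ i, m i) = ∑ i, l (m i) := fun m => by
      exact map_sum (AddMonoidHom.mk' l hl_add) m Finset.univ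
    -- Since $ere$ comes from $S$, the $S$-linear map $k$ commutes with it.
    have hk : ∀ (r : R) (m : M), ((k (l (r • φ 1 • m))) : N) = φ 1 • r • (k (l m) : N) := by
      intro r m
      obtain ⟨s, hs⟩ := hcorner r
      have h1 : l (r • φ 1 • m) = s • l m := Subtype.ext (by
        change φ 1 • r • φ 1 • m = φ s • φ 1 • m
        rw [hs, smul_smul, smul_smul, smul_smul, mul_assoc _ (φ 1) (φ 1), hee])
      rw [h1, map_smul, coe_smul_cornerPart, hs, mul_smul, mul_smul]
      rw [mem_cornerPart.1 (k (l m)).2]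
    -- The expansion $m=\sum_i a_i e b_i m$ forces this formula for an extension of $k$.
    let f : M →ₗ[R] N :=
      { toFun := fun m => ∑ i, a i • (k (l (b i • m)) : N)
        map_add' := fun m m' => by
          rw [← Finset.sum_add_distrib]
          refine Finset.sum_congr rfl fun i _ => ?_
          rw [smul_add, hl_add, map_add, AddSubgroup.coe_add, smul_add]
        map_smul' := fun r m => by
          -- Expand $m$ once more and apply `hk` to the elements $b_i r a_j$; the sum over $i$ then
          -- collapses by the expansion in $N$.
          have h1 : ∀ i, (k (l (b i • r • m)) : N) =
              φ 1 • (b i * r) • ∑ j, a j • (k (l (b j • m)) : N) := by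
            intro i
            conv_lhs => rw [← hexp M m, Finset.smul_sum, Finset.smul_sum, hl_sum, map_sum,
              AddSubmonoidClass.coe_finsetSum]
            rw [Finset.smul_sum, Finset.smul_sum]
            refine Finset.sum_congr rfl fun j _ => ?_
            rw [smul_smul, smul_smul, hk, mul_smul]
          simp only [h1, RingHom.id_apply]
          rw [← hexp N (r • ∑ j, a j • (k (l (b j • m)) : N))]
          simp only [mul_smul] }
    refine ⟨ModuleCat.ofHom f, ?_⟩
    ext m
    refine Subtype.ext ?_
    change ∑ i, a i • (k (l (b i • m.1)) : N) = (k m : N)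
    conv_rhs => rw [← hexp N (k m)]
    refine Finset.sum_congr rfl fun i _ => ?_
    have h1 := hk (b i) m.1
    have h2 : l m.1 = m := Subtype.ext m.2
    rw [mem_cornerPart.1 m.2, h2] at h1
    rw [h1]
  have hess : (cornerFunctor φ).EssSurj := by
    constructor
    intro N
    obtain ⟨e⟩ := exists_cornerPart_cornerHom_equiv φ hinj hcorner N
    exact ⟨ModuleCat.of R (cornerHom φ N), ⟨e.toModuleIso⟩⟩
  have hequiv : (cornerFunctor φ).IsEquivalence :=
    ⟨hfaithful, hfullF, hess⟩
  refine ⟨⟨⟨(cornerFunctor φ).asEquivalence, ⟨?_⟩⟩⟩⟩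
  intro M N f r
  ext m
  refine Subtype.ext ?_
  -- Linearity over `𝕜`: a scalar acts as $r\cdot 1$ on one side and as $r\cdot e$ on the other, and
  -- these agree on the $e$-part.
  change algebraMap 𝕜 R r • f.hom m.1 = φ (algebraMap 𝕜 S r) • f.hom m.1
  rw [Algebra.algebraMap_eq_smul_one, Algebra.algebraMap_eq_smul_one, map_smul φ r (1 : S),
    ← map_smul f.hom, ← map_smul f.hom]
  congr 1
  nth_rw 1 [← mem_cornerPart.1 m.2]
  rw [smul_smul, smul_mul_assoc, one_mul]

end FullCorner

namespace PBDiagram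

open Sum

variable {α β γ : Type*}

/-! ### Counting singletons -/

section Count

/-- The number of singletons of a partition into pairs and singletons. -/
noncomputable def numSingletons {S : Type*} (d : PairPartition S) : ℕ :=
  {x | d.IsSingleton x}.ncard

/-- `partner d` is an involution whose fixed points are the singletons. -/
theorem numSingletons_modEq_card {S : Type*} [Finite S] (d : PairPartition S) :
    Nat.card S ≡ numSingletons d [MOD 2] := by
  classical
  have := Fintype.ofFinite S
  let f : Function.End S := partner d
  have hf : f ^ 2 ^ 1 = 1 := by
    rw [pow_one, pow_two]
    exact funext fun x => partner_partner d x
  have h := Equiv.Perm.card_fixedPoints_modEq (p := 2) hf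
  rw [Nat.card_eq_fintype_card]
  convert h using 1
  rw [numSingletons, ← Nat.card_coe_set_eq, ← Nat.card_eq_fintype_card]
  congr! 2
  ext x
  exact (partner_eq_self d x).symm

/-- This parity serves twice: it makes the exponent $s(d)/2$ of $\delta'$ exact, and it rules out
diagrams with a single singleton between the two corners. -/
theorem even_numSingletons [Finite α] (d : PBDiagram α α) : Even (numSingletons d) := by
  have h := numSingletons_modEq_card d
  rw [Nat.card_sum] at h
  rw [Nat.even_iff, ← h]
  omega

/-- The vertex of `d|d'` that comes from a vertex of `d` or of `d'`. -/
def vertex : (α ⊕ β) ⊕ (β ⊕ γ) → α ⊕ β ⊕ γ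
  | inl x => Sum.map id inl x
  | inr y => inr y

/-- The diagram of `d|d'` that a vertex of `d` or of `d'` belongs to. -/
def side : (α ⊕ β) ⊕ (β ⊕ γ) → Bool
  | inl _ => false
  | inr _ => true

/-- A vertex of `d` or of `d'` is a singleton. -/
def IsEnd (d : PBDiagram α β) (d' : PBDiagram β γ) : (α ⊕ β) ⊕ (β ⊕ γ) → Prop
  | inl x => d.IsSingleton x
  | inr y => d'.IsSingleton y

theorem vertex_side_injective :
    Function.Injective (fun p : (α ⊕ β) ⊕ (β ⊕ γ) => (vertex p, side p)) := by
  rintro (x | x) (y | y) h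
  · exact congrArg inl (Function.Injective.sumMap Function.injective_id inl_injective
      (congrArg Prod.fst h))
  · exact absurd (congrArg Prod.snd h) (by simp [side])
  · exact absurd (congrArg Prod.snd h) (by simp [side])
  · exact congrArg inr (inr_injective (congrArg Prod.fst h))

theorem follow_vertex (d : PBDiagram α β) (d' : PBDiagram β γ) (p : (α ⊕ β) ⊕ (β ⊕ γ)) :
    follow d d' (side p) (vertex p) = vertex p ↔ IsEnd d d' p := by
  rcases p with (a | b) | y
  · exact follow_false_left d d' a
  · exact follow_false_mid d d' b
  · exact follow_true_inr d d' y

/-- The fixed points that `juxt_two_ends` counts are of two kinds: actual singletons of $d$ or $d'$,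
and the free sides of outer vertices, where no diagram is attached. -/
theorem exists_vertex_or_exterior (d : PBDiagram α β) (d' : PBDiagram β γ)
    (q : (α ⊕ β ⊕ γ) × Bool) (hq : follow d d' q.2 q.1 = q.1) :
    (∃ p, IsEnd d d' p ∧ q = (vertex p, side p)) ∨
      ∃ x : α ⊕ γ, q = (Sum.map id inr x, freeSide x) := by
  have key : ∀ p, q = (vertex p, side p) → ∃ p, IsEnd d d' p ∧ q = (vertex p, side p) := by
    rintro p rfl
    exact ⟨p, (follow_vertex d d' p).1 hq, rfl⟩
  obtain ⟨a | b | c, _ | _⟩ := q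
  · exact Or.inl (key (inl (inl a)) rfl)
  · exact Or.inr ⟨inl a, rfl⟩
  · exact Or.inl (key (inl (inr b)) rfl)
  · exact Or.inl (key (inr (inl b)) rfl)
  · exact Or.inr ⟨inr c, rfl⟩
  · exact Or.inl (key (inr (inr c)) rfl)

theorem midSingle_or_exterior (d : PBDiagram α β) (d' : PBDiagram β γ) (p : (α ⊕ β) ⊕ (β ⊕ γ))
    (hp : IsEnd d d' p) :
    MidSingle d d' (vertex p) ∨ ∃ x : α ⊕ γ, vertex p = Sum.map id inr x ∧ ExtSingle d d' x := by
  rcases p with (a | b) | (b | c)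
  · exact Or.inr ⟨inl a, rfl, hp⟩
  · exact Or.inl (Or.inl hp)
  · exact Or.inl (Or.inr hp)
  · exact Or.inr ⟨inr c, rfl, hp⟩

theorem ncard_isEnd [Finite α] [Finite β] [Finite γ] (d : PBDiagram α β) (d' : PBDiagram β γ) :
    {p | IsEnd d d' p}.ncard = numSingletons d + numSingletons d' := by
  have h : {p | IsEnd d d' p} = inl '' {x | d.IsSingleton x} ∪ inr '' {y | d'.IsSingleton y} := by
    ext (x | y) <;> simp [IsEnd]
  rw [h, Set.ncard_union_eq ?_ (Set.toFinite _) (Set.toFinite _),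
    Set.ncard_image_of_injective _ inl_injective, Set.ncard_image_of_injective _ inr_injective]
  · rfl
  · rw [Set.disjoint_left]
    rintro _ ⟨x, -, rfl⟩ ⟨y, -, h⟩
    cases h

variable [Finite α] [Finite β] [Finite γ] (d : PBDiagram α β) (d' : PBDiagram β γ)

/-- The component of $x$ has exactly two ends, one of them the free side of $x$. The other is not
the free side of an outer vertex, as $x$ is alone in its part, so it is a singleton of $d$ or $d'$.
-/
theorem existsUnique_end_of_comp_isSingleton (x : α ⊕ γ) (hx : (comp d d').IsSingleton x) :
    ∃ p, (IsEnd d d' p ∧ (juxt d d').r (Sum.map id inr x) (vertex p)) ∧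
      ∀ p', IsEnd d d' p' → (juxt d d').r (Sum.map id inr x) (vertex p') → p' = p := by
  obtain ⟨q, hqp, hqf, hqr, hq⟩ := juxt_two_ends d d' (Sum.map id inr x, freeSide x)
    (follow_freeSide d d' x)
  rcases exists_vertex_or_exterior d d' q hqf with ⟨p, hp, rfl⟩ | ⟨y, rfl⟩
  · refine ⟨p, ⟨hp, hqr⟩, fun p' hp' h => ?_⟩
    rcases hq (vertex p', side p') ((follow_vertex d d' p').2 hp') h with h1 | h1
    -- A singleton of a diagram sits on the side where that diagram is attached, hence never on a
    -- free side.
    · exfalso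
      rcases p' with (a | b) | (b | c) <;> rcases x with x | x <;>
        simp [vertex, side, freeSide] at h1
    · exact vertex_side_injective h1
  · have := hx y hqr
    subst this
    exact absurd rfl hqp

theorem comp_isSingleton_of_end (x : α ⊕ γ) (p : (α ⊕ β) ⊕ (β ⊕ γ)) (hp : IsEnd d d' p)
    (h : (juxt d d').r (Sum.map id inr x) (vertex p)) : (comp d d').IsSingleton x := by
  rcases midSingle_or_exterior d d' p hp with h1 | ⟨y, h1, h2⟩
  · exact (comp_isSingleton d d' x).2 (Or.inr ⟨_, h, h1⟩)
  · rw [h1] at h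
    have hy : (comp d d').IsSingleton y := (comp_isSingleton d d' y).2 (Or.inl h2)
    have hxy : x = y := hy x ((comp d d').iseqv.symm h)
    rwa [hxy]

theorem ncard_exterior_ends :
    {p | IsEnd d d' p ∧ ∃ x : α ⊕ γ, (juxt d d').r (Sum.map id inr x) (vertex p)}.ncard =
      numSingletons (comp d d') := by
  choose f hf hf' using fun x : {x // (comp d d').IsSingleton x} =>
    existsUnique_end_of_comp_isSingleton d d' x.1 x.2
  symm
  refine Set.ncard_congr (fun x hx => f ⟨x, hx⟩) ?_ ?_ ?_
  · intro x hx
    exact ⟨(hf ⟨x, hx⟩).1, x, (hf ⟨x, hx⟩).2⟩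
  · intro x y hx hy h
    refine hy x ?_
    have h1 := (hf ⟨x, hx⟩).2
    simp only [h] at h1
    exact (juxt d d').iseqv.trans (hf ⟨y, hy⟩).2 ((juxt d d').iseqv.symm h1)
  · rintro p ⟨hp, x, hx⟩
    have hs := comp_isSingleton_of_end d d' x p hp hx
    exact ⟨x, hs, (hf' ⟨x, hs⟩ p hp hx).symm⟩

/-- The ends in question are fibred over the open strings. One end of a hidden component forces a
second, which cannot be exterior, so each fibre has two elements. Ends are counted with their side,
so a one-vertex string where two singletons meet also counts twice. -/
theorem ncard_hidden_ends :
    {p | IsEnd d d' p ∧ ¬ ∃ x : α ⊕ γ, (juxt d d').r (Sum.map id inr x) (vertex p)}.ncard =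
      2 * openStrings d d' := by
  classical
  have := Fintype.ofFinite α
  have := Fintype.ofFinite β
  have := Fintype.ofFinite γ
  set B := {p | IsEnd d d' p ∧ ¬ ∃ x : α ⊕ γ, (juxt d d').r (Sum.map id inr x) (vertex p)}
  set O := hiddenClasses (juxt d d') Mid (MidSingle d d') True with hO
  have hmid : ∀ v, (¬ ∃ x : α ⊕ γ, (juxt d d').r (Sum.map id inr x) v) →
      ∀ w, (juxt d d').r w v → Mid w := by
    rintro v hv (a | b | c) hw
    · exact absurd ⟨inl a, hw⟩ hv
    · trivial
    · exact absurd ⟨inr c, hw⟩ hv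
  have hmap : ∀ p ∈ B.toFinset, {w | (juxt d d').r w (vertex p)} ∈ O.toFinset := by
    intro p hp
    rw [Set.mem_toFinset] at hp ⊢
    refine ⟨⟨_, rfl⟩, hmid _ hp.2, iff_true_intro ⟨vertex p, (juxt d d').iseqv.refl _, ?_⟩⟩
    rcases midSingle_or_exterior d d' p hp.1 with h1 | ⟨y, h1, -⟩
    · exact h1
    · exact absurd ⟨y, by rw [h1]⟩ hp.2
  rw [Set.ncard_eq_toFinset_card', openStrings_eq, Set.ncard_eq_toFinset_card',
    Finset.card_eq_sum_card_fiberwise hmap, mul_comm, ← hO]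
  refine Finset.sum_const_nat fun C hC => ?_
  rw [Set.mem_toFinset] at hC
  obtain ⟨⟨v, rfl⟩, hM, hF⟩ := hC
  obtain ⟨w, hw, hs⟩ := hF.2 trivial
  have hE : ∀ u, (juxt d d').r u v → ∀ x : α ⊕ γ, ¬ (juxt d d').r (Sum.map id inr x) u := by
    rintro u hu (a | c) h
    · exact hM (inl a) ((juxt d d').iseqv.trans h hu)
    · exact hM (inr (inr c)) ((juxt d d').iseqv.trans h hu)
  obtain ⟨p, hp, hpw⟩ : ∃ p, IsEnd d d' p ∧ vertex p = w := by
    rcases w with a | b | c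
    · exact hs.elim
    · rcases hs with h | h
      · exact ⟨inl (inr b), h, rfl⟩
      · exact ⟨inr (inl b), h, rfl⟩
    · exact hs.elim
  subst hpw
  obtain ⟨q, hqp, hqf, hqr, hq⟩ := juxt_two_ends d d' (vertex p, side p)
    ((follow_vertex d d' p).2 hp)
  have hqv : (juxt d d').r q.1 v := (juxt d d').iseqv.trans ((juxt d d').iseqv.symm hqr) hw
  rcases exists_vertex_or_exterior d d' q hqf with ⟨p', hp', rfl⟩ | ⟨y, rfl⟩
  · rw [Finset.card_eq_two]
    refine ⟨p, p', fun h => hqp (by rw [h]), ?_⟩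
    ext r
    simp only [Finset.mem_filter, Set.mem_toFinset, Finset.mem_insert, Finset.mem_singleton]
    have hcls : ∀ u, {w | (juxt d d').r w u} = {w | (juxt d d').r w v} ↔ (juxt d d').r u v := by
      intro u
      constructor
      · intro h
        exact h.subset ((juxt d d').iseqv.refl u)
      · intro h
        ext w
        exact ⟨fun h1 => (juxt d d').iseqv.trans h1 h,
          fun h1 => (juxt d d').iseqv.trans h1 ((juxt d d').iseqv.symm h)⟩
    rw [hcls]
    constructor
    · rintro ⟨hr, hrv⟩
      rcases hq (vertex r, side r) ((follow_vertex d d' r).2 hr.1)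
        ((juxt d d').iseqv.trans hw ((juxt d d').iseqv.symm hrv)) with h1 | h1
      · exact Or.inl (vertex_side_injective h1)
      · exact Or.inr (vertex_side_injective h1)
    · rintro (rfl | rfl)
      · exact ⟨⟨hp, fun ⟨x, hx⟩ => hE _ hw x hx⟩, hw⟩
      · exact ⟨⟨hp', fun ⟨x, hx⟩ => hE _ hqv x hx⟩, hqv⟩
  · exact absurd ((juxt d d').iseqv.refl _) (hE _ hqv y)

/-- Sort the ends by whether their component reaches an outer vertex. This identity says that the
powers of $\delta'$ in the multiplication are a coboundary. -/
theorem numSingletons_add :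
    numSingletons d + numSingletons d' = 2 * openStrings d d' + numSingletons (comp d d') := by
  rw [← ncard_isEnd, ← ncard_hidden_ends, ← ncard_exterior_ends, add_comm, ← Set.ncard_union_eq ?_
    (Set.toFinite _) (Set.toFinite _)]
  · congr 1
    ext p
    by_cases h : ∃ x : α ⊕ γ, (juxt d d').r (Sum.map id inr x) (vertex p) <;>
      simp only [Set.mem_union, Set.mem_ofPred_eq, h, not_true_eq_false, not_false_eq_true,
        and_true, and_false, or_false, false_or]
  · rw [Set.disjoint_left]
    rintro p ⟨-, h1⟩ ⟨-, h2⟩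
    exact h2 h1

end Count

end PBDiagram

/-! ### Refinement of partitions into pairs and singletons -/

namespace PairPartition

variable {S : Type*}

theorem toSetoid_injective :
    Function.Injective (PairPartition.toSetoid : PairPartition S → Setoid S) := by
  intro d e h
  apply PairPartition.ext
  exact congrArg (fun T : Setoid S => T.r) h

/-- Partitions into pairs and singletons are ordered by refinement. -/
instance : PartialOrder (PairPartition S) := PartialOrder.lift _ toSetoid_injective

theorem le_iff {e d : PairPartition S} : e ≤ d ↔ ∀ x y, e.r x y → d.r x y := by
  constructor
  · intro h x y hxy
    exact h hxy
  · intro h x y hxy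
    exact h x y hxy

instance [Finite S] : Finite (PairPartition S) :=
  Finite.of_injective (fun d : PairPartition S => d.r) fun _ _ h => PairPartition.ext h

noncomputable instance [Finite S] : Fintype (PairPartition S) := Fintype.ofFinite _

/-- The elements that belong to pairs. -/
def support (d : PairPartition S) : Set S := {x | ¬ d.IsSingleton x}

theorem mem_support {d : PairPartition S} {x : S} : x ∈ d.support ↔ ∃ y, d.r x y ∧ y ≠ x := by
  simp only [support, IsSingleton, Set.mem_ofPred_eq, not_forall, exists_prop, ne_eq]

/-- The partition whose pairs are the pairs of `d` that are contained in `U`. -/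
def restrict (d : PairPartition S) (U : Set S) : PairPartition S where
  r x y := x = y ∨ (d.r x y ∧ x ∈ U ∧ y ∈ U)
  iseqv := by
    refine ⟨fun x => Or.inl rfl, ?_, ?_⟩
    · rintro x y (rfl | ⟨h, hx, hy⟩)
      · exact Or.inl rfl
      · exact Or.inr ⟨d.iseqv.symm h, hy, hx⟩
    · rintro x y z (rfl | ⟨h, hx, hy⟩) (rfl | ⟨h', hy', hz⟩)
      · exact Or.inl rfl
      · exact Or.inr ⟨h', hy', hz⟩
      · exact Or.inr ⟨h, hx, hy⟩
      · exact Or.inr ⟨d.iseqv.trans h h', hx, hz⟩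
  card_le_two := by
    rintro x y z (rfl | ⟨h, -, -⟩) (rfl | ⟨h', -, -⟩)
    · exact Or.inl rfl
    · exact Or.inl rfl
    · exact Or.inr (Or.inl rfl)
    · exact d.card_le_two x y z h h'

theorem restrict_le (d : PairPartition S) (U : Set S) : d.restrict U ≤ d := by
  rw [le_iff]
  rintro x y (rfl | ⟨h, -, -⟩)
  · exact d.iseqv.refl x
  · exact h

theorem support_restrict_subset (d : PairPartition S) (U : Set S) :
    (d.restrict U).support ⊆ U := by
  intro x hx
  obtain ⟨y, rfl | ⟨-, h, -⟩, hne⟩ := mem_support.1 hx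
  · exact absurd rfl hne
  · exact h

theorem support_restrict (d : PairPartition S) (U : Set S)
    (hU : ∀ x y, d.r x y → x ∈ U → y ∈ U) (hs : U ⊆ d.support) : (d.restrict U).support = U := by
  refine (support_restrict_subset d U).antisymm fun x hx => ?_
  obtain ⟨y, hy, hne⟩ := mem_support.1 (hs hx)
  exact mem_support.2 ⟨y, Or.inr ⟨hy, hx, hU x y hy hx⟩, hne⟩

theorem support_mono {e d : PairPartition S} (h : e ≤ d) : e.support ⊆ d.support := by
  intro x hx
  obtain ⟨y, hy, hne⟩ := mem_support.1 hx
  exact mem_support.2 ⟨y, le_iff.1 h x y hy, hne⟩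

/-- Parts have at most two elements, so a refinement either keeps a pair whole or splits it; it
keeps every pair that it touches with its support. -/
theorem rel_of_le {e d : PairPartition S} (h : e ≤ d) {x y : S} (hxy : d.r x y)
    (hx : x ∈ e.support) : e.r x y := by
  obtain ⟨z, hz, hne⟩ := mem_support.1 hx
  rcases d.card_le_two x y z hxy (le_iff.1 h _ _ hz) with rfl | rfl | rfl
  · exact e.iseqv.refl x
  · exact absurd rfl hne
  · exact hz

theorem mem_support_of_rel {d : PairPartition S} {x y : S} (hxy : d.r x y)
    (hx : x ∈ d.support) : y ∈ d.support := by
  obtain ⟨z, hz, hne⟩ := mem_support.1 hx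
  by_cases hy : y = x
  · rwa [hy]
  · exact mem_support.2 ⟨x, d.iseqv.symm hxy, fun h => hy h.symm⟩

theorem mem_support_of_le {e d : PairPartition S} (h : e ≤ d) {x y : S} (hxy : d.r x y)
    (hx : x ∈ e.support) : y ∈ e.support :=
  mem_support_of_rel (rel_of_le h hxy hx) hx

/-- A refinement of $d$ is determined by its support. Refinements are therefore handled as sets of
vertices from here on. -/
theorem restrict_support {e d : PairPartition S} (h : e ≤ d) : d.restrict e.support = e := by
  apply PairPartition.ext
  funext x y
  refine propext ⟨?_, ?_⟩
  · rintro (rfl | ⟨h1, hx, -⟩)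
    · exact e.iseqv.refl x
    · exact rel_of_le h h1 hx
  · intro h1
    by_cases hxy : x = y
    · exact Or.inl hxy
    · exact Or.inr ⟨le_iff.1 h _ _ h1, mem_support.2 ⟨y, h1, fun h => hxy h.symm⟩,
        mem_support.2 ⟨x, e.iseqv.symm h1, hxy⟩⟩

end PairPartition

namespace PBDiagram

open Sum PairPartition

variable {α β γ : Type*}

/-! ### Pairs of refinements of two diagrams -/

/-- The right singletons of `e` are the left singletons of `e'`. -/
def Matches (e : PBDiagram α β) (e' : PBDiagram β γ) : Prop :=
  ∀ b, inr b ∈ e.support ↔ inl b ∈ e'.support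

/-- The closed loops of `d|d'`. -/
def loopSet (d : PBDiagram α β) (d' : PBDiagram β γ) : Set (Set (α ⊕ β ⊕ γ)) :=
  hiddenClasses (juxt d d') Mid (MidSingle d d') False

theorem loops_eq_ncard (d : PBDiagram α β) (d' : PBDiagram β γ) :
    loops d d' = (loopSet d d').ncard := loops_eq d d'

/-- A union of components of `d|d'` that contains no singleton of `d` or `d'`. -/
structure Admissible (d : PBDiagram α β) (d' : PBDiagram β γ) (U : Set (α ⊕ β ⊕ γ)) : Prop where
  closed : ∀ v w, (juxt d d').r v w → v ∈ U → w ∈ U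
  not_end : ∀ p, IsEnd d d' p → vertex p ∉ U

/-- The part of `d` in `U`. -/
def cutLeft (d : PBDiagram α β) (U : Set (α ⊕ β ⊕ γ)) : PBDiagram α β :=
  d.restrict (Sum.map id inl ⁻¹' U)

/-- The part of `d'` in `U`. -/
def cutRight (d' : PBDiagram β γ) (U : Set (α ⊕ β ⊕ γ)) : PBDiagram β γ :=
  d'.restrict (inr ⁻¹' U)

/-- The vertices of `e|e'` that are covered by pairs, if `e` and `e'` match. -/
def jointSupport (e : PBDiagram α β) (e' : PBDiagram β γ) : Set (α ⊕ β ⊕ γ) :=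
  {v | ∃ x ∈ e.support, v = Sum.map id inl x} ∪ {v | ∃ y ∈ e'.support, v = inr y}

section

variable {d : PBDiagram α β} {d' : PBDiagram β γ} {U : Set (α ⊕ β ⊕ γ)}

/-- No vertex is lost in the cut: $U$ contains no singleton of $d$ and is closed under its lines. -/
theorem Admissible.support_cutLeft (hU : Admissible d d' U) :
    (cutLeft d U).support = Sum.map id inl ⁻¹' U :=
  support_restrict _ _ (fun x y h => hU.closed _ _ (.rel _ _ (.left x y h)))
    fun x hx hs => hU.not_end (inl x) hs hx

theorem Admissible.support_cutRight (hU : Admissible d d' U) :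
    (cutRight d' U).support = inr ⁻¹' U :=
  support_restrict _ _ (fun x y h => hU.closed _ _ (.rel _ _ (.right x y h)))
    fun x hx hs => hU.not_end (inr x) hs hx

theorem Admissible.matches_cut (hU : Admissible d d' U) :
    Matches (cutLeft d U) (cutRight d' U) := by
  intro b
  rw [hU.support_cutLeft, hU.support_cutRight]
  rfl

/-- Inside $U$ the components are unchanged, since $U$ is a union of components; outside $U$ every
line has been cut and each vertex is alone. -/
theorem Admissible.juxt_cut (hU : Admissible d d' U) (v w : α ⊕ β ⊕ γ) :
    (juxt (cutLeft d U) (cutRight d' U)).r v w ↔ v = w ∨ ((juxt d d').r v w ∧ v ∈ U) := by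
  constructor
  · intro h
    refine eqvGen_transport (fun _ _ h => h.symm)
      (fun w => v = w ∨ ((juxt d d').r v w ∧ v ∈ U)) ?_ h (Or.inl rfl)
    have key : ∀ x y, (juxt d d').r x y → x ∈ U →
        (v = x ∨ ((juxt d d').r v x ∧ v ∈ U)) → v = y ∨ ((juxt d d').r v y ∧ v ∈ U) := by
      rintro x y h1 hx (rfl | ⟨h2, hv⟩)
      · exact Or.inr ⟨h1, hx⟩
      · exact Or.inr ⟨(juxt d d').iseqv.trans h2 h1, hv⟩
    intro x y hxy
    cases hxy with
    | left x y h =>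
      rcases h with rfl | ⟨h, hx, hy⟩
      · exact id
      · exact key _ _ (.rel _ _ (.left x y h)) hx
    | right x y h =>
      rcases h with rfl | ⟨h, hx, hy⟩
      · exact id
      · exact key _ _ (.rel _ _ (.right x y h)) hx
  · rintro (rfl | ⟨h, hv⟩)
    · exact (juxt _ _).iseqv.refl _
    · refine (eqvGen_transport (fun _ _ h => h.symm)
        (fun w => w ∈ U ∧ (juxt (cutLeft d U) (cutRight d' U)).r v w) ?_ h
        ⟨hv, (juxt _ _).iseqv.refl _⟩).2
      rintro x y hxy ⟨hx, h1⟩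
      have hy : y ∈ U := hU.closed x y (.rel _ _ hxy) hx
      refine ⟨hy, (juxt _ _).iseqv.trans h1 (.rel _ _ ?_)⟩
      cases hxy with
      | left x y h => exact .left x y (Or.inr ⟨h, hx, hy⟩)
      | right x y h => exact .right x y (Or.inr ⟨h, hx, hy⟩)

theorem Admissible.comp_cut [Finite α] [Finite β] [Finite γ] (hU : Admissible d d' U) :
    comp (cutLeft d U) (cutRight d' U) = (comp d d').restrict (Sum.map id inr ⁻¹' U) := by
  apply PairPartition.ext
  funext x y
  refine propext ((hU.juxt_cut _ _).trans (or_congr ?_ ?_))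
  · exact (Function.Injective.sumMap Function.injective_id inr_injective).eq_iff
  · exact and_congr_right fun h => ⟨fun hx => ⟨hx, hU.closed _ _ h hx⟩, fun hx => hx.1⟩

theorem Admissible.support_comp_cut [Finite α] [Finite β] [Finite γ] (hU : Admissible d d' U) :
    (comp (cutLeft d U) (cutRight d' U)).support = Sum.map id inr ⁻¹' U := by
  rw [hU.comp_cut]
  refine support_restrict _ _ (fun x y h => hU.closed _ _ h) fun x hx hs => ?_
  obtain ⟨p, ⟨hp, h⟩, -⟩ := existsUnique_end_of_comp_isSingleton d d' x hs
  exact hU.not_end p hp (hU.closed _ _ h hx)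

theorem Admissible.not_midSingle (hU : Admissible d d' U) (v : α ⊕ β ⊕ γ) (hv : v ∈ U) :
    ¬ MidSingle d d' v := by
  intro h
  rcases v with a | b | c
  · exact h
  · rcases h with h | h
    · exact hU.not_end (inl (inr b)) h hv
    · exact hU.not_end (inr (inl b)) h hv
  · exact h

/-- The components created outside $U$ are isolated vertices. Those on the equator are singletons of
both cut diagrams, hence open strings, so cutting creates no new loop. -/
theorem Admissible.loopSet_cut (hU : Admissible d d' U) :
    loopSet (cutLeft d U) (cutRight d' U) = {C ∈ loopSet d d' | C ⊆ U} := by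
  have hcls : ∀ v ∈ U, {w | (juxt (cutLeft d U) (cutRight d' U)).r w v} =
      {w | (juxt d d').r w v} := by
    intro v hv
    ext w
    change (juxt (cutLeft d U) (cutRight d' U)).r w v ↔ (juxt d d').r w v
    rw [hU.juxt_cut]
    constructor
    · rintro (rfl | h)
      · exact (juxt d d').iseqv.refl _
      · exact h.1
    · intro h
      exact Or.inr ⟨h, hU.closed _ _ ((juxt d d').iseqv.symm h) hv⟩
  have hsub : ∀ v ∈ U, {w | (juxt d d').r w v} ⊆ U := fun v hv w hw =>
    hU.closed _ _ ((juxt d d').iseqv.symm hw) hv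
  have hmid : ∀ v ∈ U, ¬ MidSingle (cutLeft d U) (cutRight d' U) v := by
    rintro (a | b | c) hv h
    · exact h
    · rcases h with h | h
      · have : (inr b : α ⊕ β) ∈ (cutLeft d U).support := by rw [hU.support_cutLeft]; exact hv
        exact this h
      · have : (inl b : β ⊕ γ) ∈ (cutRight d' U).support := by rw [hU.support_cutRight]; exact hv
        exact this h
    · exact h
  ext C
  constructor
  · rintro ⟨⟨v, rfl⟩, hM, hF⟩
    have hv : v ∈ U := by
      by_contra hv
      refine hF.1 ⟨v, (juxt _ _).iseqv.refl v, ?_⟩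
      have hMv := hM v ((juxt _ _).iseqv.refl v)
      rcases v with a | b | c
      · exact hMv.elim
      · left
        by_contra h
        have : (inr b : α ⊕ β) ∈ (cutLeft d U).support := h
        rw [hU.support_cutLeft] at this
        exact hv this
      · exact hMv.elim
    rw [hcls v hv] at hM ⊢
    exact ⟨⟨⟨v, rfl⟩, hM, iff_false_intro fun ⟨w, hw, h⟩ =>
      hU.not_midSingle w (hsub v hv hw) h⟩, hsub v hv⟩
  · rintro ⟨⟨⟨v, rfl⟩, hM, -⟩, hC⟩
    have hv : v ∈ U := hC ((juxt d d').iseqv.refl v)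
    exact ⟨⟨v, (hcls v hv).symm⟩, hM, iff_false_intro fun ⟨w, hw, h⟩ =>
      hmid w (hC hw) h⟩

theorem preimage_jointSupport_left {e : PBDiagram α β} {e' : PBDiagram β γ} (h : Matches e e') :
    Sum.map id inl ⁻¹' jointSupport e e' = e.support := by
  ext x
  constructor
  · rintro (⟨y, hy, hxy⟩ | ⟨y, hy, hxy⟩)
    · rwa [Function.Injective.sumMap Function.injective_id inl_injective hxy]
    · rcases x with a | b
      · simp at hxy
      · have : y = inl b := (inr_injective hxy).symm
        subst this
        exact (h b).2 hy
  · exact fun hx => Or.inl ⟨x, hx, rfl⟩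

theorem preimage_jointSupport_right {e : PBDiagram α β} {e' : PBDiagram β γ} (h : Matches e e') :
    inr ⁻¹' jointSupport e e' = e'.support := by
  ext x
  constructor
  · rintro (⟨y, hy, hxy⟩ | ⟨y, hy, hxy⟩)
    · rcases y with a | b
      · simp at hxy
      · have : x = inl b := inr_injective hxy
        subst this
        exact (h b).1 hy
    · rwa [inr_injective hxy]
  · exact fun hx => Or.inr ⟨x, hx, rfl⟩

/-- The matching condition is what lets one cross the equator: without it the support of $e$ could
be left by following a line of $d'$. -/
theorem admissible_jointSupport {e : PBDiagram α β} {e' : PBDiagram β γ} (he : e ≤ d)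
    (he' : e' ≤ d') (h : Matches e e') : Admissible d d' (jointSupport e e') where
  closed v w hvw := by
    refine eqvGen_transport (fun _ _ h => h.symm) (fun v => v ∈ jointSupport e e') ?_ hvw
    intro x y hxy hx
    cases hxy with
    | left x y hr =>
      change x ∈ Sum.map id inl ⁻¹' jointSupport e e' at hx
      change y ∈ Sum.map id inl ⁻¹' jointSupport e e'
      rw [preimage_jointSupport_left h] at hx ⊢
      exact mem_support_of_le he hr hx
    | right x y hr =>
      change x ∈ inr ⁻¹' jointSupport e e' at hx
      change y ∈ inr ⁻¹' jointSupport e e'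
      rw [preimage_jointSupport_right h] at hx ⊢
      exact mem_support_of_le he' hr hx
  not_end := by
    rintro (x | x) hs hx
    · change x ∈ Sum.map id inl ⁻¹' jointSupport e e' at hx
      rw [preimage_jointSupport_left h] at hx
      exact support_mono he hx hs
    · change x ∈ inr ⁻¹' jointSupport e e' at hx
      rw [preimage_jointSupport_right h] at hx
      exact support_mono he' hx hs

theorem cutLeft_jointSupport {e : PBDiagram α β} {e' : PBDiagram β γ} (he : e ≤ d)
    (h : Matches e e') : cutLeft d (jointSupport e e') = e := by
  rw [cutLeft, preimage_jointSupport_left h, restrict_support he]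

theorem cutRight_jointSupport {e : PBDiagram α β} {e' : PBDiagram β γ} (he' : e' ≤ d')
    (h : Matches e e') : cutRight d' (jointSupport e e') = e' := by
  rw [cutRight, preimage_jointSupport_right h, restrict_support he']

theorem comp_mono [Finite α] [Finite β] [Finite γ] {e : PBDiagram α β} {e' : PBDiagram β γ}
    (he : e ≤ d) (he' : e' ≤ d') : comp e e' ≤ comp d d' := by
  rw [le_iff]
  intro x y h
  refine eqvGen_transport (fun _ _ h => h.symm) (fun w => (juxt d d').r (Sum.map id inr x) w) ?_ h
    ((juxt d d').iseqv.refl _)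
  intro v w hvw hv
  refine (juxt d d').iseqv.trans hv (.rel _ _ ?_)
  cases hvw with
  | left x y h => exact .left x y (le_iff.1 he _ _ h)
  | right x y h => exact .right x y (le_iff.1 he' _ _ h)

/-- The union of a set of loops of `d|d'` and of the components that are met by `f`. -/
def joinSet (d : PBDiagram α β) (d' : PBDiagram β γ) (f : PBDiagram α γ)
    (L : Set (Set (α ⊕ β ⊕ γ))) : Set (α ⊕ β ⊕ γ) :=
  {v | (∃ C ∈ L, v ∈ C) ∨ ∃ x ∈ f.support, (juxt d d').r (Sum.map id inr x) v}

theorem not_mid_exterior (x : α ⊕ γ) : ¬ Mid (Sum.map id inr x : α ⊕ β ⊕ γ) := by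
  rcases x with a | c <;> exact id

variable {f : PBDiagram α γ} {L : Set (Set (α ⊕ β ⊕ γ))}

theorem loops_subset_joinSet (hL : L ⊆ loopSet d d') :
    {C ∈ loopSet d d' | C ⊆ joinSet d d' f L} = L := by
  ext C
  constructor
  · rintro ⟨⟨⟨v, rfl⟩, hM, -⟩, hC⟩
    rcases hC ((juxt d d').iseqv.refl v) with ⟨C', hC', hv⟩ | ⟨x, -, h⟩
    · have : C' = {w | (juxt d d').r w v} := by
        obtain ⟨⟨u, rfl⟩, -⟩ := hL hC'
        ext w
        exact ⟨fun h => (juxt d d').iseqv.trans h ((juxt d d').iseqv.symm hv),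
          fun h => (juxt d d').iseqv.trans h hv⟩
      rwa [← this]
    · exact absurd (hM _ h) (not_mid_exterior x)
  · exact fun hC => ⟨hL hC, fun v hv => Or.inl ⟨C, hC, hv⟩⟩

variable [Finite α] [Finite β] [Finite γ]

/-- A loop has no ends by definition. A component met by the support of $f\le d\circ d'$ has none
either, since an end would make its outer vertices singletons of $d\circ d'$. -/
theorem admissible_joinSet (hf : f ≤ comp d d') (hL : L ⊆ loopSet d d') :
    Admissible d d' (joinSet d d' f L) where
  closed := by
    rintro v w hvw (⟨C, hC, hv⟩ | ⟨x, hx, h⟩)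
    · left
      refine ⟨C, hC, ?_⟩
      obtain ⟨⟨u, rfl⟩, -⟩ := hL hC
      exact (juxt d d').iseqv.trans ((juxt d d').iseqv.symm hvw) hv
    · exact Or.inr ⟨x, hx, (juxt d d').iseqv.trans h hvw⟩
  not_end := by
    rintro p hp (⟨C, hC, hv⟩ | ⟨x, hx, h⟩)
    · obtain ⟨-, hM, hF⟩ := hL hC
      rcases midSingle_or_exterior d d' p hp with h1 | ⟨y, h1, -⟩
      · exact hF.1 ⟨_, hv, h1⟩
      · have := hM _ hv
        rw [h1] at this
        exact not_mid_exterior y this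
    · exact support_mono hf hx (comp_isSingleton_of_end d d' x p hp h)

theorem preimage_joinSet (hf : f ≤ comp d d') (hL : L ⊆ loopSet d d') :
    Sum.map id inr ⁻¹' joinSet d d' f L = f.support := by
  ext x
  constructor
  · rintro (⟨C, hC, hv⟩ | ⟨y, hy, h⟩)
    · exact absurd ((hL hC).2.1 _ hv) (not_mid_exterior x)
    · exact mem_support_of_le hf h hy
  · exact fun hx => Or.inr ⟨x, hx, (juxt d d').iseqv.refl _⟩

/-- A component inside $U$ either reaches an outer vertex, and is recorded by the composite of the
cuts, or is hidden without ends, and is a loop. So $U$ is recovered from the composite and its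
loops. -/
theorem Admissible.joinSet_eq (hU : Admissible d d' U) :
    joinSet d d' (comp (cutLeft d U) (cutRight d' U)) {C ∈ loopSet d d' | C ⊆ U} = U := by
  ext v
  constructor
  · rintro (⟨C, hC, hv⟩ | ⟨x, hx, h⟩)
    · exact hC.2 hv
    · rw [hU.support_comp_cut] at hx
      exact hU.closed _ _ h hx
  · intro hv
    by_cases hx : ∃ x : α ⊕ γ, (juxt d d').r (Sum.map id inr x) v
    · obtain ⟨x, hx⟩ := hx
      refine Or.inr ⟨x, ?_, hx⟩
      rw [hU.support_comp_cut]
      exact hU.closed _ _ ((juxt d d').iseqv.symm hx) hv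
    · have hsub : {w | (juxt d d').r w v} ⊆ U := fun w hw =>
        hU.closed _ _ ((juxt d d').iseqv.symm hw) hv
      refine Or.inl ⟨{w | (juxt d d').r w v}, ⟨⟨⟨v, rfl⟩, ?_, iff_false_intro ?_⟩, hsub⟩,
        (juxt d d').iseqv.refl v⟩
      · rintro (a | b | c) hw
        · exact absurd ⟨inl a, hw⟩ hx
        · trivial
        · exact absurd ⟨inr c, hw⟩ hx
      · rintro ⟨w, hw, h⟩
        exact hU.not_midSingle w (hsub hw) h

end

open Classical in
/-- The matching pairs of refinements of `d` and `d'` with a given composite are parametrized by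
the sets of loops of `d|d'`. -/
theorem sum_matches_pow_loops [Finite α] [Finite β] [Finite γ] {A : Type*} [CommSemiring A] (t : A)
    (d : PBDiagram α β) (d' : PBDiagram β γ) (f : PBDiagram α γ) (hf : f ≤ comp d d') :
    ∑ p : PBDiagram α β × PBDiagram β γ with
      (p.1 ≤ d ∧ p.2 ≤ d' ∧ Matches p.1 p.2 ∧ comp p.1 p.2 = f), t ^ loops p.1 p.2 =
    (t + 1) ^ loops d d' := by
  have hfin : (loopSet d d').Finite := Set.toFinite _
  -- The binomial theorem, written as a sum over the subsets of the set of loops.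
  have h1 : (t + 1) ^ loops d d' = ∑ L ∈ hfin.toFinset.powerset, t ^ L.card := by
    rw [loops_eq_ncard, Set.ncard_eq_toFinset_card _ hfin, ← Finset.sum_pow_mul_eq_add_pow]
    simp only [one_pow, mul_one]
  have hsub : ∀ L ∈ hfin.toFinset.powerset, (L : Set (Set (α ⊕ β ⊕ γ))) ⊆ loopSet d d' := by
    intro L hL C hC
    exact hfin.mem_toFinset.1 (Finset.mem_powerset.1 hL hC)
  rw [h1]
  symm
  -- The chosen loops are exactly those of the cut pair. This yields both the injectivity of the
  -- parametrization and the exponent of $t$.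
  have hloops : ∀ L : Finset (Set (α ⊕ β ⊕ γ)), L ∈ hfin.toFinset.powerset →
      loopSet (cutLeft d (joinSet d d' f L)) (cutRight d' (joinSet d d' f L)) = L := by
    intro L hL
    rw [(admissible_joinSet hf (hsub L hL)).loopSet_cut, loops_subset_joinSet (hsub L hL)]
  refine Finset.sum_bij
    (fun L _ => (cutLeft d (joinSet d d' f L), cutRight d' (joinSet d d' f L))) ?_ ?_ ?_ ?_
  · intro L hL
    have hU := admissible_joinSet hf (hsub L hL)
    rw [Finset.mem_filter]
    refine ⟨Finset.mem_univ _, restrict_le _ _, restrict_le _ _, hU.matches_cut, ?_⟩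
    rw [hU.comp_cut, preimage_joinSet hf (hsub L hL), restrict_support hf]
  · intro L hL L' hL' h
    have h2 := hloops L hL
    obtain ⟨h3, h4⟩ := Prod.mk.inj h
    rw [h3, h4, hloops L' hL'] at h2
    exact Finset.coe_injective h2.symm
  · rintro ⟨e, e'⟩ hp
    obtain ⟨-, he, he', hm, rfl⟩ := Finset.mem_filter.1 hp
    -- For surjectivity, the preimage of $(e,e')$ consists of the loops of $d|d'$ that lie in the
    -- joint support.
    have hU := admissible_jointSupport he he' hm
    have hL : {C ∈ loopSet d d' | C ⊆ jointSupport e e'}.Finite := Set.toFinite _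
    refine ⟨hL.toFinset, ?_, ?_⟩
    · rw [Finset.mem_powerset]
      exact Set.Finite.toFinset_mono fun C hC => hC.1
    · have h3 := hU.joinSet_eq
      simp only [cutLeft_jointSupport he hm, cutRight_jointSupport he' hm] at h3
      simp only [Set.Finite.coe_toFinset, h3, cutLeft_jointSupport he hm,
        cutRight_jointSupport he' hm]
  · intro L hL
    rw [loops_eq_ncard, hloops L hL, Set.ncard_coe_finset]

end PBDiagram

/-! ### A basis of the partial Brauer algebra that is adapted to the decomposition of lines -/

namespace PartialBrauerAlgebra

open PBDiagram PairPartition TwistedMonoidAlgebra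

variable {𝕜 : Type*} [CommRing 𝕜] {n : ℕ} (δ δ' : 𝕜)

open Classical in
/-- The product of two diagrams whose lines have the value `δ - 1` when closed: it is zero unless
singletons meet singletons. -/
noncomputable def matchedProduct (e e' : PBDiagram (Fin n) (Fin n)) :
    PBDiagram (Fin n) (Fin n) →₀ 𝕜 :=
  if Matches e e' then (δ - 1) ^ loops e e' • Finsupp.single (comp e e') 1 else 0

/-- The bilinear extension of `matchedProduct`. -/
noncomputable def matchedMul : (PBDiagram (Fin n) (Fin n) →₀ 𝕜) →ₗ[𝕜]
    (PBDiagram (Fin n) (Fin n) →₀ 𝕜) →ₗ[𝕜] (PBDiagram (Fin n) (Fin n) →₀ 𝕜) :=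
  Finsupp.basisSingleOne.constr 𝕜 fun e =>
    Finsupp.basisSingleOne.constr 𝕜 fun e' => matchedProduct δ e e'

theorem matchedMul_single (e e' : PBDiagram (Fin n) (Fin n)) :
    matchedMul δ (Finsupp.single e 1) (Finsupp.single e' 1) = matchedProduct δ e e' := by
  have h : ∀ e : PBDiagram (Fin n) (Fin n), Finsupp.single e (1 : 𝕜) =
    Finsupp.basisSingleOne e := fun e => by simp
  rw [h, h, matchedMul, Module.Basis.constr_basis, Module.Basis.constr_basis]

open Classical in
/-- The sum of all refinements of a diagram, rescaled so that open strings get the value `1`. -/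
noncomputable def refinementSum : PartialBrauerAlgebra n δ δ' →ₗ[𝕜]
    (PBDiagram (Fin n) (Fin n) →₀ 𝕜) :=
  (basis (partialBrauerCocycle n δ δ')).constr 𝕜 fun d =>
    δ' ^ (numSingletons d / 2) • ∑ e with e ≤ d, Finsupp.single e 1

open Classical in
theorem refinementSum_basis (d : PBDiagram (Fin n) (Fin n)) :
    refinementSum δ δ' (basis _ d) =
      δ' ^ (numSingletons d / 2) • ∑ e with e ≤ d, Finsupp.single e 1 := by
  rw [refinementSum, Module.Basis.constr_basis]

open Classical in
-- Group the matching pairs by their composite $f$; each $f\le d\circ d'$ receives the same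
-- coefficient.
theorem sum_matchedProduct (d d' : PBDiagram (Fin n) (Fin n)) :
    ∑ e with e ≤ d, ∑ e' with e' ≤ d', matchedProduct δ e e' =
      δ ^ loops d d' • ∑ f with f ≤ comp d d', Finsupp.single f 1 := by
  have h1 : ∑ e with e ≤ d, ∑ e' with e' ≤ d', matchedProduct δ e e' =
      ∑ p : PBDiagram (Fin n) (Fin n) × PBDiagram (Fin n) (Fin n) with
        (p.1 ≤ d ∧ p.2 ≤ d' ∧ Matches p.1 p.2),
        (δ - 1) ^ loops p.1 p.2 • Finsupp.single (comp p.1 p.2) 1 := by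
    rw [← Finset.sum_product']
    simp only [matchedProduct]
    rw [← Finset.sum_filter]
    refine Finset.sum_congr ?_ fun _ _ => rfl
    ext p
    simp [and_assoc]
  rw [h1, Finset.smul_sum, ← Finset.sum_fiberwise_of_maps_to
    (t := ({f | f ≤ comp d d'} : Finset (PBDiagram (Fin n) (Fin n))))
    (g := fun p : PBDiagram (Fin n) (Fin n) × PBDiagram (Fin n) (Fin n) => comp p.1 p.2)]
  · refine Finset.sum_congr rfl fun f hf => ?_
    have hf' : f ≤ comp d d' := (Finset.mem_filter.1 hf).2
    have h2 := sum_matches_pow_loops (δ - 1) d d' f hf'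
    -- The parameter shift: loops valued $\delta-1$, each either kept or dropped, add up to
    -- $(\delta-1)+1=\delta$.
    rw [sub_add_cancel] at h2
    rw [← h2, Finset.sum_smul, Finset.filter_filter]
    simp only [and_assoc]
    refine Finset.sum_congr rfl fun p hp => ?_
    rw [(Finset.mem_filter.1 hp).2.2.2.2]
  · intro p hp
    obtain ⟨-, h2, h3, -⟩ := Finset.mem_filter.1 hp
    exact Finset.mem_filter.2 ⟨Finset.mem_univ _, comp_mono h2 h3⟩

theorem half_numSingletons_add (d d' : PBDiagram (Fin n) (Fin n)) :
    numSingletons d / 2 + numSingletons d' / 2 =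
      openStrings d d' + numSingletons (comp d d') / 2 := by
  have h := numSingletons_add d d'
  obtain ⟨a, ha⟩ := even_numSingletons d
  obtain ⟨b, hb⟩ := even_numSingletons d'
  obtain ⟨c, hc⟩ := even_numSingletons (comp d d')
  omega

/-- Checked on basis vectors, where `sum_matchedProduct` accounts for the loops and
`half_numSingletons_add` for the open strings. Only the bilinear map on the target is needed, not
its associativity. -/
theorem refinementSum_mul (x y : PartialBrauerAlgebra n δ δ') :
    refinementSum δ δ' (x * y) = matchedMul δ (refinementSum δ δ' x) (refinementSum δ δ' y) := by
  have h : (mulBilin (partialBrauerCocycle n δ δ')).compr₂ (refinementSum δ δ') =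
      (matchedMul δ).compl₁₂ (refinementSum δ δ') (refinementSum δ δ') := by
    refine (basis _).ext fun d => (basis _).ext fun d' => ?_
    rw [LinearMap.compr₂_apply, LinearMap.compl₁₂_apply, mulBilin_basis, map_smul,
      refinementSum_basis, refinementSum_basis, refinementSum_basis, map_smul, map_smul,
      LinearMap.smul_apply]
    simp only [map_sum, LinearMap.sum_apply, matchedMul_single]
    rw [Finset.sum_comm, sum_matchedProduct, mul_def, smul_smul, smul_smul, smul_smul]
    congr 1
    change δ ^ loops d d' * δ' ^ openStrings d d' * δ' ^ (numSingletons (comp d d') / 2) = _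
    rw [mul_assoc, ← pow_add, ← half_numSingletons_add, pow_add]
    ring
  exact LinearMap.congr_fun₂ h x y

variable {δ'}

/-- The map is triangular for refinement with powers of the unit $\delta'$ on the diagonal, so each
diagram is reached by induction on its refinements. -/
theorem refinementSum_surjective (hδ' : IsUnit δ') :
    Function.Surjective (refinementSum (n := n) δ δ') := by
  classical
  have h : ∀ e : PBDiagram (Fin n) (Fin n),
      Finsupp.single e 1 ∈ LinearMap.range (refinementSum δ δ') := by
    intro e
    induction e using WellFoundedLT.induction with
    | ind e ih =>
      have h1 : (∑ f with f ≤ e, Finsupp.single f 1 : PBDiagram (Fin n) (Fin n) →₀ 𝕜) ∈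
          LinearMap.range (refinementSum δ δ') := by
        obtain ⟨u, hu⟩ := (hδ'.pow (numSingletons e / 2)).exists_left_inv
        refine ⟨u • basis _ e, ?_⟩
        rw [map_smul, refinementSum_basis, smul_smul, hu, one_smul]
      have h2 : ({f | f ≤ e} : Finset (PBDiagram (Fin n) (Fin n))) =
          insert e ({f | f < e} : Finset (PBDiagram (Fin n) (Fin n))) := by
        ext f
        simp [le_iff_eq_or_lt]
      rw [h2, Finset.sum_insert (by simp)] at h1
      refine (Submodule.add_mem_iff_left _ ?_).1 h1
      exact Submodule.sum_mem _ fun f hf => ih f (Finset.mem_filter.1 hf).2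
  rw [← LinearMap.range_eq_top, eq_top_iff, ← Finsupp.basisSingleOne.span_eq, Submodule.span_le]
  rintro _ ⟨e, rfl⟩
  rw [Finsupp.coe_basisSingleOne]
  exact h e

/-- Source and target are free of the same finite rank, and a surjective endomorphism of a finitely
generated module over a commutative ring is injective. -/
theorem refinementSum_bijective (hδ' : IsUnit δ') :
    Function.Bijective (refinementSum (n := n) δ δ') := by
  refine ⟨?_, refinementSum_surjective δ hδ'⟩
  let b := basis (partialBrauerCocycle n δ δ')
  let g : (PBDiagram (Fin n) (Fin n) →₀ 𝕜) →ₗ[𝕜] (PBDiagram (Fin n) (Fin n) →₀ 𝕜) :=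
    refinementSum δ δ' ∘ₗ b.repr.symm.toLinearMap
  have h : Function.Injective g := OrzechProperty.injective_of_surjective_endomorphism g
    ((refinementSum_surjective δ hδ').comp b.repr.symm.surjective)
  have h1 : refinementSum δ δ' = g ∘ₗ b.repr.toLinearMap := by
    refine LinearMap.ext fun x => ?_
    exact congrArg (refinementSum δ δ') (b.repr.symm_apply_apply x).symm
  rw [h1]
  exact h.comp b.repr.injective

/-- The basis of the partial Brauer algebra in which the lines are complementary to the pairs of
singletons. -/
noncomputable def pureBasis (hδ' : IsUnit δ') :
    Module.Basis (PBDiagram (Fin n) (Fin n)) 𝕜 (PartialBrauerAlgebra n δ δ') :=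
  .ofRepr (.ofBijective (refinementSum δ δ') (refinementSum_bijective δ hδ'))

variable (hδ' : IsUnit δ')

theorem refinementSum_pureBasis (e : PBDiagram (Fin n) (Fin n)) :
    refinementSum δ δ' (pureBasis δ hδ' e) = Finsupp.single e 1 :=
  (pureBasis δ hδ').repr_self e

theorem pureBasis_mul_of_matches {e e' : PBDiagram (Fin n) (Fin n)} (h : Matches e e') :
    (pureBasis δ hδ' e * pureBasis δ hδ' e' : PartialBrauerAlgebra n δ δ') =
      (δ - 1) ^ loops e e' • pureBasis δ hδ' (comp e e') := by
  apply (refinementSum_bijective δ hδ').1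
  rw [refinementSum_mul, refinementSum_pureBasis, refinementSum_pureBasis, matchedMul_single,
    map_smul, refinementSum_pureBasis, matchedProduct, if_pos h]

theorem pureBasis_mul_of_not_matches {e e' : PBDiagram (Fin n) (Fin n)} (h : ¬ Matches e e') :
    (pureBasis δ hδ' e * pureBasis δ hδ' e' : PartialBrauerAlgebra n δ δ') = 0 := by
  apply (refinementSum_bijective δ hδ').1
  rw [refinementSum_mul, refinementSum_pureBasis, refinementSum_pureBasis, matchedMul_single,
    map_zero, matchedProduct, if_neg h]

open Classical in
-- The identity diagram has no singletons, so its scaling factor is 1. Its refinements are the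
-- partial identities, which makes this the decomposition $1=\sum_S e_S$.
theorem one_eq_sum_pureBasis :
    (1 : PartialBrauerAlgebra n δ δ') = ∑ e with e ≤ PBDiagram.one (Fin n), pureBasis δ hδ' e := by
  apply (refinementSum_bijective δ hδ').1
  have h : numSingletons (PBDiagram.one (Fin n)) = 0 := by
    rw [numSingletons, Set.ncard_eq_zero]
    exact Set.eq_empty_of_forall_notMem (brauer (Fin n)).one_mem'
  rw [map_sum]
  simp only [refinementSum_pureBasis]
  refine (refinementSum_basis δ δ' (PBDiagram.one (Fin n))).trans ?_
  rw [h, Nat.zero_div, pow_zero, one_smul]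

end PartialBrauerAlgebra

/-! ### Transport of partitions along injections, and partitions from involutions -/

namespace PairPartition

variable {S T : Type*}

/-- The partition induced along an injective map. -/
def comap (h : S → T) (hh : Function.Injective h) (d : PairPartition T) : PairPartition S where
  toSetoid := d.toSetoid.comap h
  card_le_two x y z hxy hxz := by
    rcases d.card_le_two _ _ _ hxy hxz with h1 | h1 | h1
    · exact Or.inl (hh h1)
    · exact Or.inr (Or.inl (hh h1))
    · exact Or.inr (Or.inr (hh h1))

/-- The image of a partition under an injective map, extended by singletons. -/
def extend (h : S → T) (hh : Function.Injective h) (d : PairPartition S) : PairPartition T where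
  r x y := x = y ∨ ∃ x' y', d.r x' y' ∧ x = h x' ∧ y = h y'
  iseqv := by
    refine ⟨fun x => Or.inl rfl, ?_, ?_⟩
    · rintro x y (rfl | ⟨x', y', h1, rfl, rfl⟩)
      · exact Or.inl rfl
      · exact Or.inr ⟨y', x', d.iseqv.symm h1, rfl, rfl⟩
    · rintro x y z (rfl | ⟨x', y', h1, rfl, rfl⟩) (rfl | ⟨y'', z', h2, h3, rfl⟩)
      · exact Or.inl rfl
      · exact Or.inr ⟨y'', z', h2, h3, rfl⟩
      · exact Or.inr ⟨x', y', h1, rfl, rfl⟩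
      · cases hh h3
        exact Or.inr ⟨x', z', d.iseqv.trans h1 h2, rfl, rfl⟩
  card_le_two := by
    rintro x y z (rfl | ⟨x', y', h1, rfl, rfl⟩) (rfl | ⟨x'', z', h2, h3, rfl⟩)
    · exact Or.inl rfl
    · exact Or.inl rfl
    · exact Or.inr (Or.inl rfl)
    · cases hh h3
      rcases d.card_le_two _ _ _ h1 h2 with h4 | h4 | h4
      · exact Or.inl (congrArg h h4)
      · exact Or.inr (Or.inl (congrArg h h4))
      · exact Or.inr (Or.inr (congrArg h h4))

theorem support_extend (h : S → T) (hh : Function.Injective h) (d : PairPartition S) :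
    (d.extend h hh).support = h '' d.support := by
  ext x
  rw [mem_support]
  constructor
  · rintro ⟨y, rfl | ⟨x', y', h1, rfl, rfl⟩, hne⟩
    · exact absurd rfl hne
    · exact ⟨x', mem_support.2 ⟨y', h1, fun h2 => hne (congrArg h h2)⟩, rfl⟩
  · rintro ⟨x', hx, rfl⟩
    obtain ⟨y, hy, hne⟩ := mem_support.1 hx
    exact ⟨h y, Or.inr ⟨x', y, hy, rfl, rfl⟩, fun h1 => hne (hh h1)⟩

theorem extend_injective (h : S → T) (hh : Function.Injective h) :
    Function.Injective (extend h hh) := by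
  intro d e hde
  have key : ∀ d : PairPartition S, ∀ x y, d.r x y ↔ (d.extend h hh).r (h x) (h y) := by
    intro d x y
    constructor
    · exact fun h1 => Or.inr ⟨x, y, h1, rfl, rfl⟩
    · rintro (h1 | ⟨x', y', h1, h2, h3⟩)
      · rw [hh h1]
      · rwa [hh h2, hh h3]
  apply PairPartition.ext
  funext x y
  exact propext ((key d x y).trans (hde ▸ (key e x y).symm))

theorem extend_comap (h : S → T) (hh : Function.Injective h) (d : PairPartition T)
    (hd : d.support ⊆ Set.range h) : (d.comap h hh).extend h hh = d := by
  apply PairPartition.ext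
  funext x y
  refine propext ⟨?_, ?_⟩
  · rintro (rfl | ⟨x', y', h1, rfl, rfl⟩)
    · exact d.iseqv.refl _
    · exact h1
  · intro h1
    by_cases hxy : x = y
    · exact Or.inl hxy
    · obtain ⟨x', rfl⟩ := hd (mem_support.2 ⟨y, h1, fun h => hxy h.symm⟩)
      obtain ⟨y', rfl⟩ := hd (mem_support.2 ⟨h x', d.iseqv.symm h1, hxy⟩)
      exact Or.inr ⟨x', y', h1, rfl, rfl⟩

theorem mem_support_comap (h : S → T) (hh : Function.Injective h) (d : PairPartition T)
    (hd : d.support ⊆ Set.range h) (x : S) : x ∈ (d.comap h hh).support ↔ h x ∈ d.support := by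
  conv_rhs => rw [← extend_comap h hh d hd, support_extend]
  exact (Function.Injective.mem_set_image hh).symm

/-- The partition into the orbits of an involution. -/
def ofInvolution (p : S → S) (hp : ∀ x, p (p x) = x) : PairPartition S where
  r x y := y = x ∨ y = p x
  iseqv := by
    refine ⟨fun x => Or.inl rfl, ?_, ?_⟩
    · rintro x y (rfl | rfl)
      · exact Or.inl rfl
      · exact Or.inr (hp x).symm
    · rintro x y z (rfl | rfl) (rfl | rfl)
      · exact Or.inl rfl
      · exact Or.inr rfl
      · exact Or.inr rfl
      · exact Or.inl (hp x)
  card_le_two := by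
    rintro x y z (rfl | rfl) (rfl | rfl)
    · exact Or.inl rfl
    · exact Or.inl rfl
    · exact Or.inr (Or.inl rfl)
    · exact Or.inr (Or.inr rfl)

theorem mem_support_ofInvolution (p : S → S) (hp : ∀ x, p (p x) = x) (x : S) :
    x ∈ (ofInvolution p hp).support ↔ p x ≠ x := by
  rw [mem_support]
  constructor
  · rintro ⟨y, rfl | rfl, hne⟩
    · exact absurd rfl hne
    · exact hne
  · exact fun h => ⟨p x, Or.inr rfl, h⟩

end PairPartition

namespace PBDiagram

open Sum PairPartition

variable {α β : Type*}

/-! ### Adding singletons to diagrams -/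

section AddSingletons

variable (g : α → β) (hg : Function.Injective g)

/-- The diagram on a larger set of vertices, where the new vertices are singletons. -/
def addSingletons (d : PBDiagram α α) : PBDiagram β β :=
  d.extend (Sum.map g g) (hg.sumMap hg)

theorem inl_mem_support_addSingletons (d : PBDiagram α α) (a : α) :
    inl (g a) ∈ (addSingletons g hg d).support ↔ inl a ∈ d.support := by
  rw [addSingletons, support_extend]
  exact Function.Injective.mem_set_image (hg.sumMap hg) (a := inl a)

theorem inr_mem_support_addSingletons (d : PBDiagram α α) (a : α) :
    inr (g a) ∈ (addSingletons g hg d).support ↔ inr a ∈ d.support := by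
  rw [addSingletons, support_extend]
  exact Function.Injective.mem_set_image (hg.sumMap hg) (a := inr a)

theorem support_brauer [Finite α] (d : brauer α) : d.1.support = Set.univ :=
  Set.eq_univ_of_forall d.2

theorem support_addSingletons_brauer [Finite α] (d : brauer α) :
    (addSingletons g hg d.1).support = Set.range (Sum.map g g) := by
  rw [addSingletons, support_extend, support_brauer, Set.image_univ]

theorem inl_mem_support_addSingletons_brauer [Finite α] (d : brauer α) (b : β) :
    inl b ∈ (addSingletons g hg d.1).support ↔ b ∈ Set.range g := by
  rw [support_addSingletons_brauer]
  constructor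
  · rintro ⟨x | x, h⟩
    · exact ⟨x, inl_injective h⟩
    · cases h
  · rintro ⟨x, rfl⟩
    exact ⟨inl x, rfl⟩

theorem inr_mem_support_addSingletons_brauer [Finite α] (d : brauer α) (b : β) :
    inr b ∈ (addSingletons g hg d.1).support ↔ b ∈ Set.range g := by
  rw [support_addSingletons_brauer]
  constructor
  · rintro ⟨x | x, h⟩
    · cases h
    · exact ⟨x, inr_injective h⟩
  · rintro ⟨x, rfl⟩
    exact ⟨inr x, rfl⟩

/-- The new vertices carry no lines, so the old components are carried over and each new vertex is
alone. -/
theorem juxt_addSingletons (d d' : PBDiagram α α) (v w : β ⊕ β ⊕ β) :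
    (juxt (addSingletons g hg d) (addSingletons g hg d')).r v w ↔ v = w ∨ ∃ v' w',
      (juxt d d').r v' w' ∧ v = Sum.map g (Sum.map g g) v' ∧ w = Sum.map g (Sum.map g g) w' := by
  have hG : Function.Injective (Sum.map g (Sum.map g g)) := hg.sumMap (hg.sumMap hg)
  have hinl : ∀ x : α ⊕ α, Sum.map id inl (Sum.map g g x) =
      Sum.map g (Sum.map g g) (Sum.map id inl x : α ⊕ α ⊕ α) := by
    rintro (x | x) <;> rfl
  constructor
  · intro h
    refine eqvGen_transport (fun _ _ h => h.symm) (fun w => v = w ∨ ∃ v' w',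
      (juxt d d').r v' w' ∧ v = Sum.map g (Sum.map g g) v' ∧ w = Sum.map g (Sum.map g g) w')
      ?_ h (Or.inl rfl)
    have key : ∀ x y, (juxt d d').r x y → (v = Sum.map g (Sum.map g g) x ∨ ∃ v' w',
        (juxt d d').r v' w' ∧ v = Sum.map g (Sum.map g g) v' ∧
          Sum.map g (Sum.map g g) x = Sum.map g (Sum.map g g) w') →
        (v = Sum.map g (Sum.map g g) y ∨ ∃ v' w', (juxt d d').r v' w' ∧
          v = Sum.map g (Sum.map g g) v' ∧
          Sum.map g (Sum.map g g) y = Sum.map g (Sum.map g g) w') := by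
      rintro x y hxy (rfl | ⟨v', w', h1, rfl, h2⟩)
      · exact Or.inr ⟨x, y, hxy, rfl, rfl⟩
      · rw [← hG h2] at h1
        exact Or.inr ⟨v', y, (juxt d d').iseqv.trans h1 hxy, rfl, rfl⟩
    intro x y hxy
    cases hxy with
    | left x y h =>
      rcases h with rfl | ⟨x', y', h, rfl, rfl⟩
      · exact id
      · rw [hinl, hinl]
        exact key _ _ (.rel _ _ (.left x' y' h))
    | right x y h =>
      rcases h with rfl | ⟨x', y', h, rfl, rfl⟩
      · exact id
      · exact key _ _ (.rel _ _ (.right x' y' h))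
  · rintro (rfl | ⟨v', w', h, rfl, rfl⟩)
    · exact (juxt _ _).iseqv.refl _
    · refine eqvGen_transport (fun _ _ h => h.symm)
        (fun w' => (juxt (addSingletons g hg d) (addSingletons g hg d')).r
          (Sum.map g (Sum.map g g) v') (Sum.map g (Sum.map g g) w')) ?_ h
        ((juxt _ _).iseqv.refl _)
      intro x y hxy hx
      refine (juxt _ _).iseqv.trans hx (.rel _ _ ?_)
      cases hxy with
      | left x y h =>
        rw [← hinl, ← hinl]
        exact .left _ _ (Or.inr ⟨x, y, h, rfl, rfl⟩)
      | right x y h => exact .right _ _ (Or.inr ⟨x, y, h, rfl, rfl⟩)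

theorem comp_addSingletons [Finite α] [Finite β] (d d' : PBDiagram α α) :
    comp (addSingletons g hg d) (addSingletons g hg d') = addSingletons g hg (comp d d') := by
  have hext : ∀ (x : β ⊕ β) (v : α ⊕ α ⊕ α), Sum.map id inr x = Sum.map g (Sum.map g g) v ↔
      ∃ x', v = Sum.map id inr x' ∧ x = Sum.map g g x' := by
    rintro (x | x) (v | v | v) <;> simp
  apply PairPartition.ext
  funext x y
  refine propext ((juxt_addSingletons g hg d d' _ _).trans (or_congr ?_ ?_))
  · exact (Function.Injective.sumMap Function.injective_id inr_injective).eq_iff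
  · constructor
    · rintro ⟨v, w, h, hv, hw⟩
      obtain ⟨x', rfl, rfl⟩ := (hext x v).1 hv
      obtain ⟨y', rfl, rfl⟩ := (hext y w).1 hw
      exact ⟨x', y', h, rfl, rfl⟩
    · rintro ⟨x', y', h, rfl, rfl⟩
      exact ⟨_, _, h, (hext _ _).2 ⟨x', rfl, rfl⟩, (hext _ _).2 ⟨y', rfl, rfl⟩⟩

/-- A new vertex on the equator is a singleton of both diagrams, hence an open string. No loop is
gained, and the pure basis is blind to open strings. -/
theorem loopSet_addSingletons (d d' : PBDiagram α α) :
    loopSet (addSingletons g hg d) (addSingletons g hg d') =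
      (fun C => Sum.map g (Sum.map g g) '' C) '' loopSet d d' := by
  have hG : Function.Injective (Sum.map g (Sum.map g g)) := hg.sumMap (hg.sumMap hg)
  have hcls : ∀ v, {w | (juxt (addSingletons g hg d) (addSingletons g hg d')).r w
      (Sum.map g (Sum.map g g) v)} = Sum.map g (Sum.map g g) '' {w | (juxt d d').r w v} := by
    intro v
    ext w
    change (juxt (addSingletons g hg d) (addSingletons g hg d')).r w _ ↔ _
    rw [juxt_addSingletons]
    constructor
    · rintro (rfl | ⟨w', v', h, rfl, h1⟩)
      · exact ⟨v, (juxt d d').iseqv.refl v, rfl⟩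
      · cases hG h1
        exact ⟨w', h, rfl⟩
    · rintro ⟨w', h, rfl⟩
      exact Or.inr ⟨w', v, h, rfl, rfl⟩
  have hmid : ∀ v : α ⊕ α ⊕ α, Mid (Sum.map g (Sum.map g g) v) ↔ Mid v := by
    rintro (v | v | v) <;> exact Iff.rfl
  have hsingle : ∀ v : α ⊕ α ⊕ α, MidSingle (addSingletons g hg d) (addSingletons g hg d')
      (Sum.map g (Sum.map g g) v) ↔ MidSingle d d' v := by
    rintro (v | v | v)
    · exact Iff.rfl
    · exact or_congr (not_iff_not.1 (inr_mem_support_addSingletons g hg d v))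
        (not_iff_not.1 (inl_mem_support_addSingletons g hg d' v))
    · exact Iff.rfl
  have hiff : ∀ C : Set (α ⊕ α ⊕ α), ((∀ x ∈ Sum.map g (Sum.map g g) '' C, Mid x) ∧
      ((∃ x ∈ Sum.map g (Sum.map g g) '' C,
        MidSingle (addSingletons g hg d) (addSingletons g hg d') x) ↔ False)) ↔
      ((∀ x ∈ C, Mid x) ∧ ((∃ x ∈ C, MidSingle d d' x) ↔ False)) := by
    intro C
    simp only [Set.forall_mem_image, Set.exists_mem_image, hmid, hsingle]
  ext C
  constructor
  · rintro ⟨⟨v, rfl⟩, hM, hF⟩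
    obtain ⟨v', rfl⟩ : ∃ v', Sum.map g (Sum.map g g) v' = v := by
      have hMv := hM v ((juxt _ _).iseqv.refl v)
      rcases v with v | v | v
      · exact hMv.elim
      · by_contra hv
        refine hF.1 ⟨_, (juxt _ _).iseqv.refl _, Or.inl ?_⟩
        by_contra h
        change inr v ∈ (addSingletons g hg d).support at h
        rw [addSingletons, support_extend] at h
        obtain ⟨x | x, -, hx⟩ := h
        · cases hx
        · exact hv ⟨inr (inl x), congrArg (fun y => inr (inl y)) (inr_injective hx)⟩
      · exact hMv.elim
    rw [hcls] at hM hF ⊢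
    exact ⟨_, ⟨⟨v', rfl⟩, (hiff _).1 ⟨hM, hF⟩⟩, rfl⟩
  · rintro ⟨_, ⟨⟨v, rfl⟩, h⟩, rfl⟩
    exact ⟨⟨_, (hcls v).symm⟩, (hiff _).2 h⟩

theorem loops_addSingletons (d d' : PBDiagram α α) :
    loops (addSingletons g hg d) (addSingletons g hg d') = loops d d' := by
  have hG : Function.Injective (Sum.map g (Sum.map g g)) := hg.sumMap (hg.sumMap hg)
  rw [loops_eq_ncard, loops_eq_ncard, loopSet_addSingletons,
    Set.ncard_image_of_injective _ hG.image_injective]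

theorem exists_addSingletons_eq [Finite α] (d : PBDiagram β β)
    (hl : ∀ b, inl b ∈ d.support ↔ b ∈ Set.range g)
    (hr : ∀ b, inr b ∈ d.support ↔ b ∈ Set.range g) :
    ∃ d₀ : brauer α, addSingletons g hg d₀.1 = d := by
  have hd : d.support ⊆ Set.range (Sum.map g g) := by
    rintro (b | b) hb
    · obtain ⟨a, rfl⟩ := (hl b).1 hb
      exact ⟨inl a, rfl⟩
    · obtain ⟨a, rfl⟩ := (hr b).1 hb
      exact ⟨inr a, rfl⟩
  refine ⟨⟨d.comap (Sum.map g g) (hg.sumMap hg), fun x => ?_⟩, extend_comap _ _ d hd⟩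
  refine (mem_support_comap (Sum.map g g) (hg.sumMap hg) d hd x).2 ?_
  rcases x with a | a
  · exact (hl _).2 ⟨a, rfl⟩
  · exact (hr _).2 ⟨a, rfl⟩

end AddSingletons

/-! ### Partial identities -/

/-- The partial identity diagram with parts `{i, i'}` for `i ∈ S`. -/
def idOn (S : Set α) : PBDiagram α α := (one α).restrict {x | Sum.elim id id x ∈ S}

theorem support_idOn (S : Set α) : (idOn S).support = {x | Sum.elim id id x ∈ S} := by
  refine support_restrict _ _ ?_ ?_
  · intro x y h hx
    change Sum.elim id id y ∈ S
    rwa [← show Sum.elim id id x = Sum.elim id id y from h]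
  · rintro (x | x) -
    · exact mem_support.2 ⟨inr x, rfl, by simp⟩
    · exact mem_support.2 ⟨inl x, rfl, by simp⟩

theorem inl_mem_support_idOn (S : Set α) (x : α) : inl x ∈ (idOn S).support ↔ x ∈ S := by
  rw [support_idOn]; rfl

theorem inr_mem_support_idOn (S : Set α) (x : α) : inr x ∈ (idOn S).support ↔ x ∈ S := by
  rw [support_idOn]; rfl

theorem idOn_le_one (S : Set α) : idOn S ≤ one α := restrict_le _ _

theorem inl_mem_support_iff_inr_of_le_one {e : PBDiagram α α} (he : e ≤ one α) (x : α) :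
    inl x ∈ e.support ↔ inr x ∈ e.support :=
  ⟨mem_support_of_le he rfl, mem_support_of_le he rfl⟩

/-- A refinement is determined by its support, and below the identity $i$ and $i'$ enter the support
together. -/
theorem eq_idOn_of_le_one {e : PBDiagram α α} (he : e ≤ one α) :
    e = idOn {x | inl x ∈ e.support} := by
  rw [idOn]
  conv_lhs => rw [← restrict_support he]
  congr 1
  ext (x | x)
  · exact Iff.rfl
  · exact (inl_mem_support_iff_inr_of_le_one he x).symm

theorem addSingletons_one [Finite α] (g : α → β) (hg : Function.Injective g) :
    addSingletons g hg (1 : brauer α).1 = idOn (Set.range g) := by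
  have h : addSingletons g hg (1 : brauer α).1 ≤ one β := by
    rw [le_iff]
    rintro x y (rfl | ⟨x', y', h, rfl, rfl⟩)
    · exact (one β).iseqv.refl _
    · have h1 : Sum.elim id id x' = Sum.elim id id y' := h
      rcases x' with x' | x' <;> rcases y' with y' | y' <;>
        exact congrArg g h1
  rw [eq_idOn_of_le_one h]
  congr 1
  ext b
  exact inl_mem_support_addSingletons_brauer g hg 1 b

/-- The reflected diagram. -/
def flip (d : PBDiagram α β) : PBDiagram β α := d.comap Sum.swap Sum.swap_leftInverse.injective

theorem mem_support_flip (d : PBDiagram α β) (x : β ⊕ α) :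
    x ∈ d.flip.support ↔ x.swap ∈ d.support :=
  mem_support_comap _ _ d (fun y _ => ⟨y.swap, Sum.swap_swap y⟩) x

theorem matches_flip (d : PBDiagram α β) : Matches d d.flip :=
  fun b => (mem_support_flip d (inl b)).symm

/-- Without left arcs, each supported left vertex crosses to the right and the reflection brings it
straight back. Right arcs meet their mirror images and only produce loops. -/
theorem comp_flip [Finite α] [Finite β] (d : PBDiagram α β)
    (hd : ∀ x y, d.r (inl x) (inl y) → x = y) : comp d d.flip = idOn {x | inl x ∈ d.support} := by
  have hrel : ∀ x, inl x ∈ d.support → (comp d d.flip).r (inl x) (inr x) := by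
    intro x hx
    obtain ⟨y | y, hy, hne⟩ := mem_support.1 hx
    · exact absurd (congrArg inl (hd _ _ hy).symm) hne
    · exact (juxt d d.flip).iseqv.trans (.rel _ _ (.left (inl x) (inr y) hy))
        (.rel _ _ (.right (inl y) (inr x) (d.iseqv.symm hy)))
  have hle : idOn {x | inl x ∈ d.support} ≤ comp d d.flip := by
    rw [le_iff]
    rintro x y (rfl | ⟨h, hx, hy⟩)
    · exact (comp d d.flip).iseqv.refl _
    · have h1 : Sum.elim id id x = Sum.elim id id y := h
      rcases x with x | x <;> rcases y with y | y <;>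
        simp only [Sum.elim_inl, Sum.elim_inr, id] at h1
      all_goals subst h1
      · exact (comp d d.flip).iseqv.refl _
      · exact hrel x hx
      · exact (comp d d.flip).iseqv.symm (hrel x hx)
      · exact (comp d d.flip).iseqv.refl _
  have hsupp : (comp d d.flip).support = (idOn {x | inl x ∈ d.support}).support := by
    refine Set.Subset.antisymm ?_ (support_mono hle)
    rw [support_idOn]
    intro x hx
    by_contra h
    refine hx ((comp_isSingleton d d.flip x).2 (Or.inl ?_))
    by_contra h1
    refine h ?_
    rcases x with x | x
    · exact h1
    · exact (mem_support_flip d (inr x)).1 h1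
  -- A refinement with full support is the whole diagram.
  rw [← restrict_support hle, ← hsupp, restrict_support le_rfl]

end PBDiagram

/-! ### Partial transpositions and partial identities with an arc -/

namespace PBDiagram

open Sum PairPartition

variable {α : Type*} [DecidableEq α]

open Classical in
/-- The partial permutation diagram of the transposition of `i` and `j` with left support `S`. -/
noncomputable def swapOn (S : Set α) (i j : α) : PBDiagram α α :=
  ofInvolution (Sum.elim
    (fun x => if x ∈ S then inr (Equiv.swap i j x) else inl x)
    (fun y => if Equiv.swap i j y ∈ S then inl (Equiv.swap i j y) else inr y)) (by
    rintro (x | x)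
    · by_cases h : x ∈ S <;> simp [h]
    · by_cases h : Equiv.swap i j x ∈ S <;> simp [h])

theorem inl_mem_support_swapOn (S : Set α) (i j x : α) :
    inl x ∈ (swapOn S i j).support ↔ x ∈ S := by
  rw [swapOn, mem_support_ofInvolution]
  by_cases h : x ∈ S <;> simp [h]

theorem inr_mem_support_swapOn (S : Set α) (i j y : α) :
    inr y ∈ (swapOn S i j).support ↔ Equiv.swap i j y ∈ S := by
  rw [swapOn, mem_support_ofInvolution]
  by_cases h : Equiv.swap i j y ∈ S <;> simp [h]

theorem eq_of_swapOn_rel (S : Set α) (i j x y : α) (h : (swapOn S i j).r (inl x) (inl y)) :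
    x = y := by
  rcases h with h | h
  · exact (inl_injective h).symm
  · by_cases hx : x ∈ S <;> simp [hx] at h
    exact h.symm

open Classical in
/-- The partial identity on `S` together with the right arc from `i'` to `j'`. -/
noncomputable def arcOn (S : Set α) (i j : α) (hi : i ∉ S) (hj : j ∉ S) : PBDiagram α α :=
  ofInvolution (Sum.elim
    (fun x => if x ∈ S then inr x else inl x)
    (fun y => if y ∈ S then inl y else inr (Equiv.swap i j y))) (by
    rintro (x | x)
    · by_cases h : x ∈ S <;> simp [h]
    · by_cases h : x ∈ S
      · simp [h]
      -- The transposition preserves the complement of $S$ because neither $i$ nor $j$ lies in $S$.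
      · have h1 : Equiv.swap i j x ∉ S := by
          rw [Equiv.swap_apply_def]
          split_ifs <;> assumption
        simp [h, h1])

theorem inl_mem_support_arcOn (S : Set α) (i j : α) (hi : i ∉ S) (hj : j ∉ S) (x : α) :
    inl x ∈ (arcOn S i j hi hj).support ↔ x ∈ S := by
  rw [arcOn, mem_support_ofInvolution]
  by_cases h : x ∈ S <;> simp [h]

theorem inr_mem_support_arcOn (S : Set α) (i j : α) (hi : i ∉ S) (hj : j ∉ S) (hij : i ≠ j)
    (y : α) : inr y ∈ (arcOn S i j hi hj).support ↔ y ∈ S ∪ {i, j} := by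
  rw [arcOn, mem_support_ofInvolution]
  by_cases h : y ∈ S
  · simp [h]
  · simp [h, Equiv.swap_apply_ne_self_iff, hij]

theorem eq_of_arcOn_rel (S : Set α) (i j : α) (hi : i ∉ S) (hj : j ∉ S) (x y : α)
    (h : (arcOn S i j hi hj).r (inl x) (inl y)) : x = y := by
  rcases h with h | h
  · exact (inl_injective h).symm
  · by_cases hx : x ∈ S <;> simp [hx] at h
    exact h.symm

end PBDiagram

namespace PartialBrauerAlgebra

open PBDiagram PairPartition TwistedMonoidAlgebra Sum

variable {𝕜 : Type*} [CommRing 𝕜] {n : ℕ} (δ : 𝕜) {δ' : 𝕜} (hδ' : IsUnit δ')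

/-! ### Multiplication by partial identities -/

/-- Multiply by $1=\sum_{S'}e_{S'}$ on the right: only $S'=S$ matches the right support of $d$, so
$e_S$ acts as 1. -/
theorem pureBasis_mul_idOn (d : PBDiagram (Fin n) (Fin n)) (S : Set (Fin n))
    (h : ∀ x, inr x ∈ d.support ↔ x ∈ S) :
    (pureBasis δ hδ' d * pureBasis δ hδ' (idOn S) : PartialBrauerAlgebra n δ δ') =
      pureBasis δ hδ' d := by
  classical
  conv_rhs => rw [← mul_one (pureBasis δ hδ' d : PartialBrauerAlgebra n δ δ'),
    one_eq_sum_pureBasis δ hδ', Finset.mul_sum]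
  symm
  refine Finset.sum_eq_single (idOn S) ?_ ?_
  · intro e he hne
    refine pureBasis_mul_of_not_matches δ hδ' fun hm => hne ?_
    rw [eq_idOn_of_le_one (Finset.mem_filter.1 he).2]
    congr 1
    ext x
    exact (hm x).symm.trans (h x)
  · intro hS
    exact (hS (by simpa using idOn_le_one S)).elim

theorem idOn_mul_pureBasis (d : PBDiagram (Fin n) (Fin n)) (S : Set (Fin n))
    (h : ∀ x, inl x ∈ d.support ↔ x ∈ S) :
    (pureBasis δ hδ' (idOn S) * pureBasis δ hδ' d : PartialBrauerAlgebra n δ δ') =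
      pureBasis δ hδ' d := by
  classical
  conv_rhs => rw [← one_mul (pureBasis δ hδ' d : PartialBrauerAlgebra n δ δ'),
    one_eq_sum_pureBasis δ hδ', Finset.sum_mul]
  symm
  refine Finset.sum_eq_single (idOn S) ?_ ?_
  · intro e he hne
    have he' := (Finset.mem_filter.1 he).2
    refine pureBasis_mul_of_not_matches δ hδ' fun hm => hne ?_
    rw [eq_idOn_of_le_one he']
    congr 1
    ext x
    exact (inl_mem_support_iff_inr_of_le_one he' x).trans ((hm x).trans (h x))
  · intro hS
    exact (hS (by simpa using idOn_le_one S)).elim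

theorem pureBasis_mul_idOn_of_not (d : PBDiagram (Fin n) (Fin n)) (S : Set (Fin n))
    (h : ¬ ∀ x, inr x ∈ d.support ↔ x ∈ S) :
    (pureBasis δ hδ' d * pureBasis δ hδ' (idOn S) : PartialBrauerAlgebra n δ δ') = 0 :=
  pureBasis_mul_of_not_matches δ hδ' fun hm =>
    h fun x => (hm x).trans (inl_mem_support_idOn S x)

theorem idOn_mul_pureBasis_of_not (d : PBDiagram (Fin n) (Fin n)) (S : Set (Fin n))
    (h : ¬ ∀ x, inl x ∈ d.support ↔ x ∈ S) :
    (pureBasis δ hδ' (idOn S) * pureBasis δ hδ' d : PartialBrauerAlgebra n δ δ') = 0 :=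
  pureBasis_mul_of_not_matches δ hδ' fun hm =>
    h fun x => (hm x).symm.trans (inr_mem_support_idOn S x)

/-! ### Brauer algebras as corners -/

section Embedding

variable {m : ℕ} (g : Fin m → Fin n) (hg : Function.Injective g)

/-- The embedding of the Brauer algebra with parameter `δ - 1` into the partial Brauer algebra. -/
noncomputable def ofBrauer : BrauerAlgebra m (δ - 1) →ₗ[𝕜] PartialBrauerAlgebra n δ δ' :=
  (basis (brauerCocycle m (δ - 1))).constr 𝕜 fun d => pureBasis δ hδ' (addSingletons g hg d.1)

theorem ofBrauer_basis (d : brauer (Fin m)) :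
    ofBrauer δ hδ' g hg (basis _ d) = pureBasis δ hδ' (addSingletons g hg d.1) := by
  rw [ofBrauer, Module.Basis.constr_basis]

theorem ofBrauer_one : ofBrauer δ hδ' g hg 1 = pureBasis δ hδ' (idOn (Set.range g)) := by
  rw [← addSingletons_one g hg]
  exact ofBrauer_basis δ hδ' g hg 1

/-- All these diagrams have left and right support equal to the range of $g$, so they always match,
and the remaining factor $(\delta-1)^k$ is the Brauer cocycle. -/
theorem ofBrauer_mul (x y : BrauerAlgebra m (δ - 1)) :
    ofBrauer δ hδ' g hg (x * y) = ofBrauer δ hδ' g hg x * ofBrauer δ hδ' g hg y := by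
  have h : (mulBilin (brauerCocycle m (δ - 1))).compr₂ (ofBrauer δ hδ' g hg) =
      (mulBilin (partialBrauerCocycle n δ δ')).compl₁₂ (ofBrauer δ hδ' g hg)
        (ofBrauer δ hδ' g hg) := by
    refine (basis _).ext fun d => (basis _).ext fun d' => ?_
    rw [LinearMap.compr₂_apply, LinearMap.compl₁₂_apply, mulBilin_basis, map_smul,
      ofBrauer_basis, ofBrauer_basis, ofBrauer_basis]
    refine Eq.trans ?_ (pureBasis_mul_of_matches δ hδ' fun b => ?_).symm
    · rw [loops_addSingletons, comp_addSingletons]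
      rfl
    · rw [inr_mem_support_addSingletons_brauer, inl_mem_support_addSingletons_brauer]
  exact LinearMap.congr_fun₂ h x y

theorem ofBrauer_mul_ofBrauer_eq_zero {m' : ℕ} (g' : Fin m' → Fin n)
    (hg' : Function.Injective g') (hne : Set.range g ≠ Set.range g') (x : BrauerAlgebra m (δ - 1))
    (y : BrauerAlgebra m' (δ - 1)) : ofBrauer δ hδ' g hg x * ofBrauer δ hδ' g' hg' y = 0 := by
  have h : (mulBilin (partialBrauerCocycle n δ δ')).compl₁₂ (ofBrauer δ hδ' g hg)
      (ofBrauer δ hδ' g' hg') = 0 := by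
    refine (basis _).ext fun d => (basis _).ext fun d' => ?_
    rw [LinearMap.compl₁₂_apply, ofBrauer_basis, ofBrauer_basis]
    refine pureBasis_mul_of_not_matches δ hδ' fun hm => hne ?_
    ext b
    rw [← inr_mem_support_addSingletons_brauer g hg d, hm b,
      inl_mem_support_addSingletons_brauer]
  exact LinearMap.congr_fun₂ h x y

/-- Distinct Brauer diagrams go to distinct vectors of the pure basis. -/
theorem ofBrauer_injective : Function.Injective (ofBrauer δ hδ' g hg) := by
  let b := basis (brauerCocycle m (δ - 1))
  have hli : LinearIndependent 𝕜 fun d : brauer (Fin m) =>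
      pureBasis δ hδ' (addSingletons g hg d.1) :=
    (pureBasis δ hδ').linearIndependent.comp _
      ((extend_injective _ (hg.sumMap hg)).comp Subtype.val_injective)
  have h : ∀ x, ofBrauer δ hδ' g hg x = Finsupp.linearCombination 𝕜
      (fun d : brauer (Fin m) => pureBasis δ hδ' (addSingletons g hg d.1)) (b.repr x) :=
    fun x => Module.Basis.constr_apply _ _ _ x
  intro x y hxy
  rw [h, h] at hxy
  exact b.repr.injective (hli hxy)

end Embedding

/-- The embedding of a product of two Brauer algebras as a (non-unital) subalgebra. -/
noncomputable def ofBrauerProd {m m' : ℕ} (g : Fin m → Fin n) (hg : Function.Injective g)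
    (g' : Fin m' → Fin n) (hg' : Function.Injective g') (hne : Set.range g ≠ Set.range g') :
    (BrauerAlgebra m (δ - 1) × BrauerAlgebra m' (δ - 1)) →ₙₐ[𝕜] PartialBrauerAlgebra n δ δ' where
  toFun p := ofBrauer δ hδ' g hg p.1 + ofBrauer δ hδ' g' hg' p.2
  map_smul' r p := by
    rw [Prod.smul_fst, Prod.smul_snd, map_smul, map_smul, smul_add]
    rfl
  map_zero' := by rw [Prod.fst_zero, Prod.snd_zero, map_zero, map_zero, add_zero]
  map_add' p q := by
    rw [Prod.fst_add, Prod.snd_add, map_add, map_add, add_add_add_comm]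
  map_mul' p q := by
    rw [Prod.fst_mul, Prod.snd_mul, ofBrauer_mul, ofBrauer_mul, add_mul, mul_add, mul_add,
      ofBrauer_mul_ofBrauer_eq_zero δ hδ' g hg g' hg' hne,
      ofBrauer_mul_ofBrauer_eq_zero δ hδ' g' hg' g hg hne.symm, add_zero, zero_add]

section Prod

variable {m m' : ℕ} (g : Fin m → Fin n) (hg : Function.Injective g)
    (g' : Fin m' → Fin n) (hg' : Function.Injective g') (hne : Set.range g ≠ Set.range g')

theorem ofBrauerProd_apply (p : BrauerAlgebra m (δ - 1) × BrauerAlgebra m' (δ - 1)) :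
    ofBrauerProd δ hδ' g hg g' hg' hne p =
      ofBrauer δ hδ' g hg p.1 + ofBrauer δ hδ' g' hg' p.2 := rfl

theorem ofBrauerProd_one : ofBrauerProd δ hδ' g hg g' hg' hne 1 =
    pureBasis δ hδ' (idOn (Set.range g)) + pureBasis δ hδ' (idOn (Set.range g')) := by
  rw [ofBrauerProd_apply, Prod.fst_one, Prod.snd_one, ofBrauer_one, ofBrauer_one]

theorem ofBrauerProd_injective : Function.Injective (ofBrauerProd δ hδ' g hg g' hg' hne) := by
  rw [injective_iff_map_eq_zero]
  rintro ⟨x, y⟩ h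
  rw [ofBrauerProd_apply] at h
  have hx : ofBrauer δ hδ' g hg x = 0 := by
    -- Multiplication by the first idempotent kills the second summand, which separates the two
    -- components.
    have h1 := congrArg (fun z => ofBrauer δ hδ' g hg 1 * z) h
    simpa only [mul_add, mul_zero, ← ofBrauer_mul, one_mul, add_zero,
      ofBrauer_mul_ofBrauer_eq_zero δ hδ' g hg g' hg' hne] using h1
  have hy : ofBrauer δ hδ' g' hg' y = 0 := by
    rw [hx, zero_add] at h
    exact h
  rw [Prod.mk_eq_zero]
  exact ⟨(map_eq_zero_iff _ (ofBrauer_injective δ hδ' g hg)).1 hx,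
    (map_eq_zero_iff _ (ofBrauer_injective δ hδ' g' hg')).1 hy⟩

/-- The image of `ofBrauerProd` is a corner if no diagram has different left and right supports
among the ranges of the two maps. -/
theorem exists_ofBrauerProd_eq
    (hodd : ∀ d : PBDiagram (Fin n) (Fin n), ¬ ((∀ x, inl x ∈ d.support ↔ x ∈ Set.range g) ∧
      ∀ x, inr x ∈ d.support ↔ x ∈ Set.range g'))
    (hodd' : ∀ d : PBDiagram (Fin n) (Fin n), ¬ ((∀ x, inl x ∈ d.support ↔ x ∈ Set.range g') ∧
      ∀ x, inr x ∈ d.support ↔ x ∈ Set.range g)) (r : PartialBrauerAlgebra n δ δ') :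
    ∃ s, ofBrauerProd δ hδ' g hg g' hg' hne s = ofBrauerProd δ hδ' g hg g' hg' hne 1 * r *
      ofBrauerProd δ hδ' g hg g' hg' hne 1 := by
  -- In $e_S\,b_d\,e_T$ a basis vector survives only if $d$ has left support $S$ and right support
  -- $T$, and is then unchanged.
  have hcross : ∀ S T : Set (Fin n), (∀ d : PBDiagram (Fin n) (Fin n),
      ¬ ((∀ x, inl x ∈ d.support ↔ x ∈ S) ∧ ∀ x, inr x ∈ d.support ↔ x ∈ T)) →
      ∀ d, (pureBasis δ hδ' (idOn S) * pureBasis δ hδ' d * pureBasis δ hδ' (idOn T) :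
        PartialBrauerAlgebra n δ δ') = 0 := by
    intro S T h d
    by_cases hS : ∀ x, inl x ∈ d.support ↔ x ∈ S
    · rw [idOn_mul_pureBasis δ hδ' d S hS, pureBasis_mul_idOn_of_not δ hδ' d T fun hT =>
        h d ⟨hS, hT⟩]
    · rw [idOn_mul_pureBasis_of_not δ hδ' d S hS, zero_mul]
  -- With both supports equal to the range of $f$, a surviving diagram is a Brauer diagram with
  -- singletons added.
  have hdiag : ∀ {k : ℕ} (f : Fin k → Fin n) (hf : Function.Injective f) d,
      ∃ s, ofBrauer δ hδ' f hf s = pureBasis δ hδ' (idOn (Set.range f)) * pureBasis δ hδ' d *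
        pureBasis δ hδ' (idOn (Set.range f)) := by
    intro k f hf d
    by_cases hl : ∀ x, inl x ∈ d.support ↔ x ∈ Set.range f
    · rw [idOn_mul_pureBasis δ hδ' d _ hl]
      by_cases hr : ∀ x, inr x ∈ d.support ↔ x ∈ Set.range f
      · obtain ⟨d₀, hd₀⟩ := exists_addSingletons_eq f hf d hl hr
        refine ⟨basis _ d₀, ?_⟩
        rw [pureBasis_mul_idOn δ hδ' d _ hr, ofBrauer_basis, hd₀]
      · exact ⟨0, by rw [pureBasis_mul_idOn_of_not δ hδ' d _ hr, map_zero]⟩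
    · exact ⟨0, by rw [idOn_mul_pureBasis_of_not δ hδ' d _ hl, zero_mul, map_zero]⟩
  have hr := (pureBasis δ hδ').mem_span r
  induction hr using Submodule.span_induction with
  | mem r hr =>
    obtain ⟨d, rfl⟩ := hr
    obtain ⟨s, hs⟩ := hdiag g hg d
    obtain ⟨s', hs'⟩ := hdiag g' hg' d
    refine ⟨(s, s'), ?_⟩
    rw [ofBrauerProd_apply, ofBrauerProd_one, hs, hs', add_mul, add_mul, mul_add, mul_add,
      hcross _ _ hodd d, hcross _ _ hodd' d, add_zero, zero_add]
  | zero => exact ⟨0, by rw [map_zero, mul_zero, zero_mul]⟩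
  | add x y _ _ hx hy =>
    obtain ⟨s, hs⟩ := hx
    obtain ⟨t, ht⟩ := hy
    exact ⟨s + t, by rw [map_add, hs, ht, mul_add, add_mul]⟩
  | smul a x _ hx =>
    obtain ⟨s, hs⟩ := hx
    exact ⟨a • s, by rw [map_smul, hs, mul_smul_comm, smul_mul_assoc]⟩

end Prod

/-! ### Fullness -/

section Full

variable {A : Type*} [Ring A] [Algebra 𝕜 A] (e : A)

theorem mul_mem_span_mul_mul (a : A) {x : A}
    (hx : x ∈ Submodule.span 𝕜 (Set.range fun p : A × A => p.1 * e * p.2)) :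
    a * x ∈ Submodule.span 𝕜 (Set.range fun p : A × A => p.1 * e * p.2) := by
  suffices h : Submodule.span 𝕜 (Set.range fun p : A × A => p.1 * e * p.2) ≤
      (Submodule.span 𝕜 (Set.range fun p : A × A => p.1 * e * p.2)).comap
        (LinearMap.mulLeft 𝕜 a) from h hx
  rw [Submodule.span_le]
  rintro _ ⟨p, rfl⟩
  refine Submodule.subset_span ⟨(a * p.1, p.2), ?_⟩
  simp only [LinearMap.mulLeft_apply, mul_assoc]

theorem mem_span_mul_mul_mul (a : A) {x : A}
    (hx : x ∈ Submodule.span 𝕜 (Set.range fun p : A × A => p.1 * e * p.2)) :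
    x * a ∈ Submodule.span 𝕜 (Set.range fun p : A × A => p.1 * e * p.2) := by
  suffices h : Submodule.span 𝕜 (Set.range fun p : A × A => p.1 * e * p.2) ≤
      (Submodule.span 𝕜 (Set.range fun p : A × A => p.1 * e * p.2)).comap
        (LinearMap.mulRight 𝕜 a) from h hx
  rw [Submodule.span_le]
  rintro _ ⟨p, rfl⟩
  refine Submodule.subset_span ⟨(p.1, p.2 * a), ?_⟩
  simp only [LinearMap.mulRight_apply, mul_assoc]

end Full

variable {δ}

/-- If a diagram without left arcs has left support `S` and right support `T`, then the idempotent
of `S` lies in the ideal generated by the idempotent of `T`. -/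
theorem idOn_mem_of_diagram (hδ : IsUnit (δ - 1)) (e : PartialBrauerAlgebra n δ δ')
    (a : PBDiagram (Fin n) (Fin n)) (ha : ∀ x y, a.r (inl x) (inl y) → x = y) (S T : Set (Fin n))
    (hS : ∀ x, inl x ∈ a.support ↔ x ∈ S) (hT : ∀ x, inr x ∈ a.support ↔ x ∈ T)
    (h : pureBasis δ hδ' (idOn T) ∈ Submodule.span 𝕜 (Set.range fun p :
      PartialBrauerAlgebra n δ δ' × PartialBrauerAlgebra n δ δ' => p.1 * e * p.2)) :
    pureBasis δ hδ' (idOn S) ∈ Submodule.span 𝕜 (Set.range fun p :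
      PartialBrauerAlgebra n δ δ' × PartialBrauerAlgebra n δ δ' => p.1 * e * p.2) := by
  have h1 := mem_span_mul_mul_mul e (pureBasis δ hδ' a.flip)
    (mul_mem_span_mul_mul e (pureBasis δ hδ' a) h)
  have hS' : {x | inl x ∈ a.support} = S := Set.ext hS
  -- With $a^*$ the reflection of $a$: $b_a\,e_T\,b_{a^*}=b_a\,b_{a^*}=(\delta-1)^l e_S$, where $l$
  -- is the number of loops of $a|a^*$. Invertibility of $\delta-1$ removes the factor.
  rw [pureBasis_mul_idOn δ hδ' a T hT, pureBasis_mul_of_matches δ hδ' (matches_flip a),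
    comp_flip a ha, hS'] at h1
  obtain ⟨u, hu⟩ := (hδ.pow (loops a a.flip)).exists_left_inv
  have h2 := Submodule.smul_mem _ u h1
  rwa [smul_smul, hu, one_smul] at h2

/-- Downward induction on $S$. If two points $i,j$ are missing, an arc at them leads to
$S\cup\{i,j\}$; if one is missing, a transposition moves it to the last place. Steps of size two
explain why both sizes $n$ and $n-1$ are needed. -/
theorem idOn_mem {m : ℕ} (hδ : IsUnit (δ - 1)) (e : PartialBrauerAlgebra (m + 1) δ δ')
    (huniv : pureBasis δ hδ' (idOn Set.univ) ∈ Submodule.span 𝕜 (Set.range fun p :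
      PartialBrauerAlgebra (m + 1) δ δ' × PartialBrauerAlgebra (m + 1) δ δ' => p.1 * e * p.2))
    (hlast : pureBasis δ hδ' (idOn {Fin.last m}ᶜ) ∈ Submodule.span 𝕜 (Set.range fun p :
      PartialBrauerAlgebra (m + 1) δ δ' × PartialBrauerAlgebra (m + 1) δ δ' => p.1 * e * p.2))
    (S : Set (Fin (m + 1))) :
    pureBasis δ hδ' (idOn S) ∈ Submodule.span 𝕜 (Set.range fun p :
      PartialBrauerAlgebra (m + 1) δ δ' × PartialBrauerAlgebra (m + 1) δ δ' =>
        p.1 * e * p.2) := by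
  induction S using WellFoundedGT.induction with
  | ind S ih =>
    by_cases hS : Sᶜ.Subsingleton
    · rcases hS.eq_empty_or_singleton with h | ⟨i, h⟩
      · rwa [Set.compl_empty_iff.1 h]
      · have hS' : S = {i}ᶜ := by rw [← h, compl_compl]
        refine idOn_mem_of_diagram hδ' hδ e (swapOn S i (Fin.last m)) (eq_of_swapOn_rel S _ _) S
          {Fin.last m}ᶜ (inl_mem_support_swapOn S _ _) (fun x => ?_) hlast
        rw [inr_mem_support_swapOn, hS', Set.mem_compl_singleton_iff,
          Set.mem_compl_singleton_iff, not_iff_not, Equiv.swap_apply_eq_iff,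
          Equiv.swap_apply_left]
    · rw [Set.not_subsingleton_iff] at hS
      obtain ⟨i, hi, j, hj, hij⟩ := hS
      refine idOn_mem_of_diagram hδ' hδ e (arcOn S i j hi hj) (eq_of_arcOn_rel S i j hi hj) S
        (S ∪ {i, j}) (inl_mem_support_arcOn S i j hi hj)
        (inr_mem_support_arcOn S i j hi hj hij) (ih _ ?_)
      exact Set.ssubset_iff_exists.2 ⟨Set.subset_union_left, i, Or.inr (Or.inl rfl), hi⟩

theorem isMoritaEquivalent_brauer_prod (m : ℕ) (hδ' : IsUnit δ')
    (hδ : IsUnit (δ - 1)) :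
    IsMoritaEquivalent 𝕜 (PartialBrauerAlgebra (m + 1) δ δ')
      (BrauerAlgebra (m + 1) (δ - 1) × BrauerAlgebra m (δ - 1)) := by
  have hcast : Set.range (Fin.castSucc : Fin m → Fin (m + 1)) = {Fin.last m}ᶜ := by
    ext x
    rw [Fin.range_castSucc, Set.mem_ofPred_eq, Set.mem_compl_singleton_iff, Fin.ne_iff_vne,
      Fin.val_last]
    omega
  have hid : Set.range (id : Fin (m + 1) → Fin (m + 1)) = Set.univ := Set.range_id
  have hne : Set.range (id : Fin (m + 1) → Fin (m + 1)) ≠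
      Set.range (Fin.castSucc : Fin m → Fin (m + 1)) := by
    rw [hid, hcast]
    intro h
    exact (h.subset (Set.mem_univ (Fin.last m))) rfl
  -- A diagram linking the two corners would have one singleton in all, the last vertex of one side.
  have hparity : ∀ (d : PBDiagram (Fin (m + 1)) (Fin (m + 1))) y,
      {x | d.IsSingleton x} ≠ {y} := by
    intro d y h
    have := even_numSingletons d
    rw [numSingletons, h, Set.ncard_singleton] at this
    exact Nat.not_even_one this
  let φ := ofBrauerProd δ hδ' (id : Fin (m + 1) → Fin (m + 1)) Function.injective_id Fin.castSucc
    (Fin.castSucc_injective m) hne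
  have hφ : φ 1 = pureBasis δ hδ' (idOn Set.univ) + pureBasis δ hδ' (idOn {Fin.last m}ᶜ) := by
    rw [← hid, ← hcast]
    exact ofBrauerProd_one _ _ _ _ _ _ _
  have hsingle : ∀ (d : PBDiagram (Fin (m + 1)) (Fin (m + 1))) x,
      d.IsSingleton x ↔ ¬ x ∈ d.support := fun d x => not_not.symm
  refine IsMoritaEquivalent.of_full_corner φ (ofBrauerProd_injective δ hδ' _ _ _ _ hne)
    (exists_ofBrauerProd_eq δ hδ' _ _ _ _ hne ?_ ?_) ?_
  · rintro d ⟨hl, hr⟩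
    refine hparity d (Sum.inr (Fin.last m)) ?_
    ext (x | x)
    · simp [hsingle, hl]
    · rw [Set.mem_ofPred_eq, hsingle, hr, hcast]
      simp
  · rintro d ⟨hl, hr⟩
    refine hparity d (Sum.inl (Fin.last m)) ?_
    ext (x | x)
    · rw [Set.mem_ofPred_eq, hsingle, hl, hcast]
      simp
    · simp [hsingle, hr]
  · classical
    -- An idempotent $e_S$ absorbed by $e=\varphi(1)$ equals $e_S\cdot e\cdot 1$, hence lies in the
    -- ideal of $e$.
    have hmem : ∀ S : Set (Fin (m + 1)),
        pureBasis δ hδ' (idOn S) * φ 1 = pureBasis δ hδ' (idOn S) →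
        pureBasis δ hδ' (idOn S) ∈ Submodule.span 𝕜 (Set.range fun p :
          PartialBrauerAlgebra (m + 1) δ δ' × PartialBrauerAlgebra (m + 1) δ δ' =>
            p.1 * φ 1 * p.2) := fun S h =>
      Submodule.subset_span ⟨(pureBasis δ hδ' (idOn S), 1), (mul_one _).trans h⟩
    have hsets : (Set.univ : Set (Fin (m + 1))) ≠ {Fin.last m}ᶜ := by
      rwa [hid, hcast] at hne
    have hall := idOn_mem hδ' hδ (φ 1) (hmem _ ?_) (hmem _ ?_)
    -- Once all $e_S$ lie in the ideal, so does their sum 1.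
    · rw [one_eq_sum_pureBasis δ hδ']
      refine Submodule.sum_mem _ fun e he => ?_
      rw [eq_idOn_of_le_one (Finset.mem_filter.1 he).2]
      exact hall _
    · rw [hφ, mul_add, pureBasis_mul_idOn δ hδ' _ _ (inr_mem_support_idOn _),
        pureBasis_mul_idOn_of_not, add_zero]
      intro h
      exact hsets (Set.ext fun x => (inr_mem_support_idOn _ x).symm.trans (h x))
    · rw [hφ, mul_add, pureBasis_mul_idOn δ hδ' _ {Fin.last m}ᶜ (inr_mem_support_idOn _),
        pureBasis_mul_idOn_of_not, zero_add]
      intro h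
      exact hsets.symm (Set.ext fun x => (inr_mem_support_idOn _ x).symm.trans (h x))

end PartialBrauerAlgebra

theorem theorem1 {𝕜 : Type*} [CommRing 𝕜] (n : ℕ) (hn : 1 ≤ n) (δ δ' : 𝕜)
    (hδ' : IsUnit δ') (hδ : IsUnit (δ - 1)) :
    IsMoritaEquivalent 𝕜 (PartialBrauerAlgebra n δ δ')
      (BrauerAlgebra n (δ - 1) × BrauerAlgebra (n - 1) (δ - 1)) := by
  obtain ⟨m, rfl⟩ : ∃ m, n = m + 1 := ⟨n - 1, by omega⟩
  exact PartialBrauerAlgebra.isMoritaEquivalent_brauer_prod m hδ' hδ
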